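/- Let $d\ge 1$. An interaction is a family $\mathbf J=\{J_B\in\mathbb R: B\subset\mathbb Z^d \text{ finite},\ |B|\ge 2\}$ with $\sup_{v}\sum_{B\ni v}|B||J_B|<\infty$. For $v\in\mathbb Z^d$ let $\mathcal B_v$ be the set of sequences $\mathbf B_v=(B_v(k))_{k\ge 0}$ of finite subsets of $\mathbb Z^d$ with $B_v(0)=\{v\}$, $B_v(k)\subsetneq B_v(k+1)$, and $\bigcup_k B_v(k)\supset A$ for every finite $A\ni v$ with $J_A\neq 0$. Put $\lambda_v(0)=e^{-2\sum_{B\ni v}|J_B|}$, $\lambda_v(1)=e^{-\sum_{B\ni v,\,B\not\subset B_v(1)}|J_B|}-\lambda_v(0)$, $\lambda_v(k)=e^{-\sum_{B\ni v,\,B\not\subset B_v(k)}|J_B|}-e^{-\sum_{B\ni v,\,B\not\subset B_v(k-1)}|J_B|}$ for $k\ge2$ (a probability distribution on $\mathbb N$), and $M_v=2e^{\sum_{B\ni v}|J_B|}$. The backward sketch process $(C_n)$ started from a finite set $C_0$ is the following Markov chain on finite subsets of $\mathbb Z^d$: if $C_n=\emptyset$ then $C_{n+1}=\emptyset$; otherwise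 select $w\in C_n$ with probability $M_w/\sum_{z\in C_n}M_z$, draw $k$ with law $\lambda_w$, and set $C_{n+1}=C_n\setminus\{w\}$ if $k=0$, and $C_{n+1}=C_n\cup B_w(k)$ if $k\ge1$. The perfect simulation algorithm of Galves–Löcherbach–Orlandi with window $C_0$ runs this chain until $C_n=\emptyset$ and then goes through the draws $(w,k)$ from the last to the first, replacing each time the spin at $w$ by a spin with law $p_w^{[k]}(\cdot\,|\,\sigma)$ on $\{-1,1\}$, where $\sigma$ is the current configuration. Here, with $\chi_B(\sigma)=\prod_{u\in B}\sigma(u)$, $p_w^{[0]}$ is uniform, $p_w^{[k]}(\sigma(w)|\sigma)=1-p_w^{[k]}(-\sigma(w)|\sigma)$, $$p_w^{[1]}(-\sigma(w)|\sigma)=\frac1{M_w}\,\frac{e^{-\sum_{B\ni w,\,B\subset B_w(1)}J_B\chi_B(\sigma)}-e^{-\sum_{B\ni w,\,B\subset B_w(1)}|J_B|}}{1-e^{-2\sum_{B\ni w,\,B\subset B_w(1)}|J_B|}\,e^{-\sum_{B\ni w,\,B\not\subset B_w(1)}|J_B|}},$$ and, for $k\ge2$, with $\mathcal D_k=\{B\ni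 w: B\subset B_w(k),\,B\not\subset B_w(k-1)\}$, $$p_w^{[k]}(-\sigma(w)|\sigma)=\frac{e^{-\sum_{B\ni w,\,B\subset B_w(k-1)}J_B\chi_B(\sigma)}}{M_w}\cdot\frac{e^{-\sum_{B\in\mathcal D_k}J_B\chi_B(\sigma)}-e^{-\sum_{B\in\mathcal D_k}|J_B|}}{1-e^{-\sum_{B\in\mathcal D_k}|J_B|}}$$ (with $0/0=0$). A Gibbs measure for $\mathbf J$ is a probability measure $\pi$ on $\{-1,1\}^{\mathbb Z^d}$ such that, for every $v$, a.s., $\pi(\sigma(v)=\zeta(v)\,|\,\sigma(u)=\zeta(u)\ \forall u\ne v)=\big(1+e^{-2\sum_{B\ni v}J_B\chi_B(\zeta)}\big)^{-1}$. A choice $(\mathbf B_v)_{v\in\mathbb Z^d}$, $\mathbf B_v\in\mathcal B_v$, satisfies (H2) if $\sum_{k\ge1}|B_v(k)|\lambda_v(k)<\infty$ for every $v$ and $$\lim_{\Lambda\uparrow\mathbb Z^d}\ \sup_{v\notin\Lambda}\ \sum_{k\ge1}|B_v(k)|\lambda_v(k)<1 ;$$ $\mathbf J$ satisfies (H2) if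 such a choice exists. $\mathbf J$ satisfies (H1) if $\sup_{v}\sum_{k\ge1}|B^*_v(k)|\lambda_v(k)<1$, where $B^*_v(k)$ is the closed $\ell^1$ ball with centre $v$ and radius $k$, and $\lambda_v$ is formed with these balls. **Theorem.** (a) If $(\mathbf B_v)_v$ satisfies (H2) for $\mathbf J$, then for every finite $C_0$ almost surely $C_n=\emptyset$ for all large $n$ (in particular $\limsup_n C_n=\emptyset$); there is exactly one Gibbs measure $\pi$ for $\mathbf J$; and for every finite $C_0$ the output of the algorithm, restricted to $C_0$, has the law of $\sigma|_{C_0}$ under $\pi$. (b) Every interaction that satisfies (H1) satisfies (H2), and there is an interaction that satisfies (H2) but not (H1). -/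

import Mathlib

open MeasureTheory ProbabilityTheory Filter Topology
open scoped ENNReal

/-- Vertices: the points of `ℤ^d`. -/
abbrev Vertex (d : ℕ) := Fin d → ℤ

/-- Spin configurations on `ℤ^d`; `ℤˣ = {1, -1}`, and the space carries the σ-algebra
generated by the coordinates. -/
abbrev Config (d : ℕ) := Vertex d → ℤˣ

/-- An interaction: real numbers `J_B` for the finite sets `B` with `|B| ≥ 2` (extended by `0` to
the other finite sets) such that `sup_v ∑_{B ∋ v} |B| |J_B| < ∞`. -/
structure Interaction (d : ℕ) where
  coupling : Finset (Vertex d) → ℝ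
  coupling_small : ∀ B, B.card < 2 → coupling B = 0
  bounded : ⨆ v : Vertex d, ∑' B : {B : Finset (Vertex d) // v ∈ B},
    ENNReal.ofReal (B.1.card * |coupling B.1|) < ⊤

namespace Interaction

variable {d : ℕ}

/-- `∑_{B ∈ 𝒜} |J_B|`. -/
noncomputable def absSum (J : Interaction d) (𝒜 : Set (Finset (Vertex d))) : ℝ :=
  ∑' B : 𝒜, |J.coupling B|

/-- `χ_B(σ) = ∏_{u ∈ B} σ(u)`, as a real number. -/
noncomputable def chi (B : Finset (Vertex d)) (σ : Config d) : ℝ :=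
  ∏ u ∈ B, (((σ u : ℤˣ) : ℤ) : ℝ)

/-- `∑_{B ∈ 𝒜} J_B χ_B(σ)`. -/
noncomputable def spinSum (J : Interaction d) (𝒜 : Set (Finset (Vertex d))) (σ : Config d) : ℝ :=
  ∑' B : 𝒜, J.coupling B * chi B σ

/-- The finite sets containing `v`. -/
def star (v : Vertex d) : Set (Finset (Vertex d)) := {B | v ∈ B}

/-- The finite sets containing `v` and contained in `D`. -/
def within (v : Vertex d) (D : Finset (Vertex d)) : Set (Finset (Vertex d)) :=
  {B | v ∈ B ∧ B ⊆ D}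

/-- The finite sets containing `v` and not contained in `D`. -/
def beyond (v : Vertex d) (D : Finset (Vertex d)) : Set (Finset (Vertex d)) :=
  {B | v ∈ B ∧ ¬ B ⊆ D}

/-- The finite sets containing `v`, contained in `D'` and not contained in `D`. -/
def shell (v : Vertex d) (D' D : Finset (Vertex d)) : Set (Finset (Vertex d)) :=
  {B | v ∈ B ∧ B ⊆ D' ∧ ¬ B ⊆ D}

/-- The mass `M_v = 2 exp(∑_{B ∋ v} |J_B|)`. -/
noncomputable def mass (J : Interaction d) (v : Vertex d) : ℝ :=
  2 * Real.exp (J.absSum (star v))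

/-- The weights `λ_v(k)` attached to a sequence of finite sets `D 0, D 1, …`. -/
noncomputable def lam (J : Interaction d) (v : Vertex d) (D : ℕ → Finset (Vertex d)) : ℕ → ℝ
  | 0 => Real.exp (-2 * J.absSum (star v))
  | 1 => Real.exp (-J.absSum (beyond v (D 1))) - Real.exp (-2 * J.absSum (star v))
  | k + 2 => Real.exp (-J.absSum (beyond v (D (k + 2))))
      - Real.exp (-J.absSum (beyond v (D (k + 1))))

/-- The probability `p_v^{[k]}(-σ(v) | σ)`. -/
noncomputable def flipProb (J : Interaction d) (v : Vertex d) (D : ℕ → Finset (Vertex d)) :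
    ℕ → Config d → ℝ
  | 0, _ => 1 / 2
  | 1, σ => 1 / J.mass v *
      ((Real.exp (-J.spinSum (within v (D 1)) σ) - Real.exp (-J.absSum (within v (D 1)))) /
        (1 - Real.exp (-2 * J.absSum (within v (D 1))) * Real.exp (-J.absSum (beyond v (D 1)))))
  | k + 2, σ => Real.exp (-J.spinSum (within v (D (k + 1))) σ) / J.mass v *
      ((Real.exp (-J.spinSum (shell v (D (k + 2)) (D (k + 1))) σ)
          - Real.exp (-J.absSum (shell v (D (k + 2)) (D (k + 1))))) /
        (1 - Real.exp (-J.absSum (shell v (D (k + 2)) (D (k + 1))))))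

/-- The update probability `p_v^{[k]}(a | σ)` of the new spin `a` at `v`. -/
noncomputable def updateProb (J : Interaction d) (v : Vertex d) (D : ℕ → Finset (Vertex d))
    (k : ℕ) (σ : Config d) (a : ℤˣ) : ℝ :=
  if a = -σ v then J.flipProb v D k σ else 1 - J.flipProb v D k σ

/-- The space `𝓑_v`: strictly increasing sequences of finite sets starting from `{v}` whose union
covers every `B ∋ v` with `J_B ≠ 0`. -/
structure Growth (J : Interaction d) (v : Vertex d) where
  seq : ℕ → Finset (Vertex d)
  seq_zero : seq 0 = {v}
  seq_succ : ∀ k, seq k ⊂ seq (k + 1)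
  cover : ∀ A : Finset (Vertex d), v ∈ A → J.coupling A ≠ 0 →
    (A : Set (Vertex d)) ⊆ ⋃ k, (seq k : Set (Vertex d))

/-- `∑_{k ≥ 1} |D k| λ_v(k)`, with values in `[0, ∞]`. -/
noncomputable def birthSum (J : Interaction d) (v : Vertex d) (D : ℕ → Finset (Vertex d)) : ℝ≥0∞ :=
  ∑' k : ℕ, ENNReal.ofReal ((D (k + 1)).card * J.lam v D (k + 1))

/-- The closed `ℓ¹` ball with centre `v` and radius `k`. -/
noncomputable def ball (v : Vertex d) (k : ℕ) : Finset (Vertex d) :=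
  (Finset.Icc (fun i => v i - k) (fun i => v i + k)).filter (fun u => ∑ i, (u i - v i).natAbs ≤ k)

/-- Condition (H1): `sup_v ∑_{k ≥ 1} |B*_v(k)| λ_v(k) < 1` for the `ℓ¹` balls `B*_v(k)`. -/
def ConditionH1 (J : Interaction d) : Prop :=
  ⨆ v : Vertex d, J.birthSum v (ball v) < 1

/-- Condition (H2) for a given choice of the sequences `B_v`: all the sums
`∑_{k ≥ 1} |B_v(k)| λ_v(k)` are finite, and the limit as `Λ ↑ ℤ^d` of their supremum over
`v ∉ Λ` is less than `1`. -/
def ConditionH2For (J : Interaction d) (B : ∀ v : Vertex d, J.Growth v) : Prop :=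
  (∀ v, J.birthSum v (B v).seq < ⊤) ∧
  ∃ ℓ : ℝ≥0∞, ℓ < 1 ∧
    Tendsto (fun Λ : Finset (Vertex d) => ⨆ (v : Vertex d) (_ : v ∉ Λ), J.birthSum v (B v).seq)
      atTop (𝓝 ℓ)

/-- Condition (H2): suitable sequences can be chosen. -/
def ConditionH2 (J : Interaction d) : Prop :=
  ∃ B : ∀ v : Vertex d, J.Growth v, J.ConditionH2For B

/-- The σ-algebra generated by the spins at the vertices other than `v`. -/
abbrev outside (v : Vertex d) : MeasurableSpace (Config d) :=
  MeasurableSpace.comap (fun σ (u : {u : Vertex d // u ≠ v}) => σ u) MeasurableSpace.pi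

/-- Gibbs measures: for every `v` and every spin `a`, the conditional probability of `σ(v) = a`
given the spins outside `v` is `1 / (1 + exp(-2 ∑_{B ∋ v} J_B χ_B(σ)))`, evaluated at the
configuration with spin `a` at `v`. -/
def IsGibbs (J : Interaction d) (π : Measure (Config d)) : Prop :=
  IsProbabilityMeasure π ∧ ∀ (v : Vertex d) (a : ℤˣ),
    π⟦{σ : Config d | σ v = a} | outside v⟧ =ᵐ[π]
      fun ζ => 1 / (1 + Real.exp (-2 * J.spinSum (star v) (Function.update ζ v a)))

/-! ### Elementary facts that make the laws below well defined -/

lemma summable_star (J : Interaction d) (v : Vertex d) :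
    Summable fun B : star v => |J.coupling B| := by
  have h1 : ∑' B : {B : Finset (Vertex d) // v ∈ B},
      ENNReal.ofReal (B.1.card * |J.coupling B.1|) ≠ ⊤ :=
    ((le_iSup (fun v : Vertex d => ∑' B : {B : Finset (Vertex d) // v ∈ B},
      ENNReal.ofReal (B.1.card * |J.coupling B.1|)) v).trans_lt J.bounded).ne
  have h2 := ENNReal.summable_toReal h1
  refine Summable.of_nonneg_of_le (fun B => abs_nonneg _) (fun B => ?_) h2
  rw [ENNReal.toReal_ofReal (by positivity)]
  have h3 : (1 : ℝ) ≤ (B.1.card : ℝ) := by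
    exact_mod_cast Finset.card_pos.mpr ⟨v, B.2⟩
  have h4 := abs_nonneg (J.coupling B.1)
  nlinarith

lemma summable_of_subset (J : Interaction d) {v : Vertex d} {𝒜 : Set (Finset (Vertex d))}
    (h : 𝒜 ⊆ star v) : Summable fun B : 𝒜 => |J.coupling B| := by
  have h1 : Summable ((star v).indicator fun B => |J.coupling B|) :=
    summable_subtype_iff_indicator.mp (J.summable_star v)
  refine (summable_subtype_iff_indicator (f := fun B => |J.coupling B|)).mpr ?_
  refine Summable.of_nonneg_of_le (fun B => ?_) (fun B => ?_) h1
  · exact Set.indicator_nonneg (fun _ _ => abs_nonneg _) _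
  · exact Set.indicator_le_indicator_of_subset h (fun _ => abs_nonneg _) B

lemma absSum_nonneg (J : Interaction d) (𝒜 : Set (Finset (Vertex d))) : 0 ≤ J.absSum 𝒜 :=
  tsum_nonneg fun _ => abs_nonneg _

lemma absSum_union (J : Interaction d) {v : Vertex d} {𝒜 𝒜' : Set (Finset (Vertex d))}
    (h : 𝒜 ⊆ star v) (h' : 𝒜' ⊆ star v) (hd : Disjoint 𝒜 𝒜') :
    J.absSum (𝒜 ∪ 𝒜') = J.absSum 𝒜 + J.absSum 𝒜' :=
  Summable.tsum_union_disjoint (f := fun B => |J.coupling B|) hd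
    (J.summable_of_subset h) (J.summable_of_subset h')

lemma absSum_mono (J : Interaction d) {v : Vertex d} {𝒜 𝒜' : Set (Finset (Vertex d))}
    (h : 𝒜 ⊆ 𝒜') (h' : 𝒜' ⊆ star v) : J.absSum 𝒜 ≤ J.absSum 𝒜' := by
  have h1 := J.absSum_union (h.trans h') (Set.sdiff_subset.trans h') (Set.disjoint_sdiff_right
    (s := 𝒜) (t := 𝒜'))
  rw [Set.union_sdiff_cancel h] at h1
  have := J.absSum_nonneg (𝒜' \ 𝒜)
  linarith

lemma abs_chi (B : Finset (Vertex d)) (σ : Config d) : |chi B σ| = 1 := by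
  unfold chi
  rw [Finset.abs_prod]
  refine Finset.prod_eq_one fun u _ => ?_
  rcases Int.units_eq_one_or (σ u) with h | h <;> simp [h]

lemma abs_spinSum_le (J : Interaction d) {v : Vertex d} {𝒜 : Set (Finset (Vertex d))}
    (h : 𝒜 ⊆ star v) (σ : Config d) : |J.spinSum 𝒜 σ| ≤ J.absSum 𝒜 := by
  have h1 : (fun B : 𝒜 => ‖J.coupling B * chi B σ‖) = fun B : 𝒜 => |J.coupling B| := by
    funext B
    rw [Real.norm_eq_abs, abs_mul, abs_chi, mul_one]
  have h3 : Summable fun B : 𝒜 => ‖J.coupling B * chi B σ‖ := by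
    rw [h1]
    exact J.summable_of_subset h
  have h2 := norm_tsum_le_tsum_norm h3
  rw [h1] at h2
  exact h2

lemma within_subset (v : Vertex d) (D : Finset (Vertex d)) : within v D ⊆ star v :=
  fun _ h => h.1

lemma beyond_subset (v : Vertex d) (D : Finset (Vertex d)) : beyond v D ⊆ star v :=
  fun _ h => h.1

lemma shell_subset (v : Vertex d) (D' D : Finset (Vertex d)) : shell v D' D ⊆ star v :=
  fun _ h => h.1

lemma mass_pos (J : Interaction d) (v : Vertex d) : 0 < J.mass v := by
  unfold mass
  positivity

lemma absSum_within_add_beyond (J : Interaction d) (v : Vertex d) (D : Finset (Vertex d)) :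
    J.absSum (within v D) + J.absSum (beyond v D) = J.absSum (star v) := by
  rw [← J.absSum_union (within_subset v D) (beyond_subset v D)]
  · congr 1
    ext B
    simp only [within, beyond, star, Set.mem_union, Set.mem_ofPred_eq]
    tauto
  · rw [Set.disjoint_left]
    exact fun B h h' => h'.2 h.2

lemma absSum_within_add_shell_le (J : Interaction d) (v : Vertex d) (D' D : Finset (Vertex d)) :
    J.absSum (within v D) + J.absSum (shell v D' D) ≤ J.absSum (star v) := by
  rw [← J.absSum_union (within_subset v D) (shell_subset v D' D)]
  · exact J.absSum_mono (Set.union_subset (within_subset v D) (shell_subset v D' D)) subset_rfl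
  · rw [Set.disjoint_left]
    exact fun B h h' => h'.2.2 h.2

lemma flipProb_mem (J : Interaction d) (v : Vertex d) (D : ℕ → Finset (Vertex d)) (k : ℕ)
    (σ : Config d) : 0 ≤ J.flipProb v D k σ ∧ J.flipProb v D k σ ≤ 1 := by
  have hM := J.mass_pos v
  match k with
  | 0 => simp only [flipProb]; norm_num
  | 1 =>
    simp only [flipProb]
    set s := J.absSum (within v (D 1)) with hs
    set t := J.absSum (beyond v (D 1)) with ht
    set e := J.spinSum (within v (D 1)) σ with he
    have h1 : |e| ≤ s := J.abs_spinSum_le (within_subset _ _) σ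
    have h0 : 0 ≤ t := J.absSum_nonneg _
    have hs0 : 0 ≤ s := J.absSum_nonneg _
    have hM' : J.mass v = 2 * Real.exp (s + t) := by
      rw [mass, ← J.absSum_within_add_beyond v (D 1)]
    have h2 := abs_le.mp h1
    have hnum : 0 ≤ Real.exp (-e) - Real.exp (-s) :=
      sub_nonneg.mpr (Real.exp_le_exp.mpr (by linarith))
    have hden : 0 ≤ 1 - Real.exp (-2 * s) * Real.exp (-t) := by
      rw [← Real.exp_add]
      exact sub_nonneg.mpr (Real.exp_le_one_iff.mpr (by linarith))
    refine ⟨by positivity, ?_⟩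
    have hq : (Real.exp (-e) - Real.exp (-s)) / (1 - Real.exp (-2 * s) * Real.exp (-t))
        ≤ Real.exp s := by
      refine div_le_of_le_mul₀ hden (Real.exp_pos s).le ?_
      have h3 : Real.exp (-e) ≤ Real.exp s := Real.exp_le_exp.mpr (by linarith)
      have h4 : Real.exp s * (Real.exp (-2 * s) * Real.exp (-t)) ≤ Real.exp (-s) := by
        rw [← Real.exp_add, ← Real.exp_add]
        exact Real.exp_le_exp.mpr (by linarith)
      linarith
    rw [one_div, inv_mul_le_iff₀ hM, mul_one, hM']
    have h5 : Real.exp s ≤ Real.exp (s + t) := Real.exp_le_exp.mpr (by linarith)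
    have h6 := Real.exp_pos (s + t)
    linarith
  | k + 2 =>
    simp only [flipProb]
    set s := J.absSum (shell v (D (k + 2)) (D (k + 1))) with hs
    set t := J.absSum (within v (D (k + 1))) with ht
    set e := J.spinSum (shell v (D (k + 2)) (D (k + 1))) σ with he
    set f := J.spinSum (within v (D (k + 1))) σ with hf
    have h1 := abs_le.mp (show |e| ≤ s from J.abs_spinSum_le (shell_subset _ _ _) σ)
    have h1' := abs_le.mp (show |f| ≤ t from J.abs_spinSum_le (within_subset _ _) σ)
    have hs0 : 0 ≤ s := J.absSum_nonneg _
    have hM' : 2 * Real.exp (t + s) ≤ J.mass v := by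
      rw [mass]
      have := Real.exp_le_exp.mpr (J.absSum_within_add_shell_le v (D (k + 2)) (D (k + 1)))
      linarith
    have hnum : 0 ≤ Real.exp (-e) - Real.exp (-s) :=
      sub_nonneg.mpr (Real.exp_le_exp.mpr (by linarith))
    have hden : 0 ≤ 1 - Real.exp (-s) :=
      sub_nonneg.mpr (Real.exp_le_one_iff.mpr (by linarith))
    refine ⟨by positivity, ?_⟩
    have hq : (Real.exp (-e) - Real.exp (-s)) / (1 - Real.exp (-s)) ≤ Real.exp s + 1 := by
      refine div_le_of_le_mul₀ hden (by positivity) ?_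
      have h3 : Real.exp (-e) ≤ Real.exp s := Real.exp_le_exp.mpr (by linarith)
      have h4 : Real.exp s * Real.exp (-s) = 1 := by
        rw [← Real.exp_add]; simp
      nlinarith
    rw [div_mul_eq_mul_div, div_le_one hM]
    have h5 : Real.exp (-f) ≤ Real.exp t := Real.exp_le_exp.mpr (by linarith)
    have h6 : 1 ≤ Real.exp s := Real.one_le_exp hs0
    calc Real.exp (-f) * ((Real.exp (-e) - Real.exp (-s)) / (1 - Real.exp (-s)))
        ≤ Real.exp t * (Real.exp s + 1) := by gcongr
      _ ≤ 2 * Real.exp (t + s) := by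
        rw [Real.exp_add]
        nlinarith [Real.exp_pos t]
      _ ≤ J.mass v := hM'

lemma updateProb_nonneg (J : Interaction d) (v : Vertex d) (D : ℕ → Finset (Vertex d)) (k : ℕ)
    (σ : Config d) (a : ℤˣ) : 0 ≤ J.updateProb v D k σ a := by
  have h := J.flipProb_mem v D k σ
  unfold updateProb
  split_ifs <;> linarith

lemma sum_updateProb (J : Interaction d) (v : Vertex d) (D : ℕ → Finset (Vertex d)) (k : ℕ)
    (σ : Config d) : ∑ a : ℤˣ, J.updateProb v D k σ a = 1 := by
  have hu : (Finset.univ : Finset ℤˣ) = {1, -1} := rfl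
  rw [hu, Finset.sum_pair (by decide)]
  unfold updateProb
  rcases Int.units_eq_one_or (σ v) with h | h <;> simp [h]

lemma seq_mono {J : Interaction d} {v : Vertex d} (D : J.Growth v) : Monotone D.seq :=
  monotone_nat_of_le_succ fun k => (D.seq_succ k).1

lemma lam_nonneg (J : Interaction d) {v : Vertex d} (D : J.Growth v) (k : ℕ) :
    0 ≤ J.lam v D.seq k := by
  match k with
  | 0 => simp only [lam]; positivity
  | 1 =>
    simp only [lam]
    refine sub_nonneg.mpr (Real.exp_le_exp.mpr ?_)
    have h1 := J.absSum_mono (beyond_subset v (D.seq 1)) subset_rfl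
    have h2 := J.absSum_nonneg (star v)
    linarith
  | k + 2 =>
    simp only [lam]
    refine sub_nonneg.mpr (Real.exp_le_exp.mpr (neg_le_neg ?_))
    refine J.absSum_mono (v := v) ?_ (beyond_subset v _)
    exact fun B h => ⟨h.1, fun h' => h.2 (h'.trans (seq_mono D (by omega)))⟩

lemma sum_lam (J : Interaction d) (v : Vertex d) (D : ℕ → Finset (Vertex d)) (n : ℕ) :
    ∑ k ∈ Finset.range (n + 2), J.lam v D k = Real.exp (-J.absSum (beyond v (D (n + 1)))) := by
  induction n with
  | zero => simp [Finset.sum_range_succ, lam]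
  | succ n ih => rw [Finset.sum_range_succ, ih]; simp [lam]

lemma tendsto_absSum_beyond (J : Interaction d) {v : Vertex d} (D : J.Growth v) :
    Tendsto (fun n => J.absSum (beyond v (D.seq n))) atTop (𝓝 0) := by
  have h0 : Summable ((star v).indicator fun B => |J.coupling B|) :=
    summable_subtype_iff_indicator.mp (J.summable_star v)
  have h1 : ∀ n, J.absSum (beyond v (D.seq n))
      = ∑' B, (beyond v (D.seq n)).indicator (fun B => |J.coupling B|) B :=
    fun n => tsum_subtype (beyond v (D.seq n)) fun B => |J.coupling B|
  simp only [h1]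
  rw [← tsum_zero (α := ℝ) (β := Finset (Vertex d))]
  refine tendsto_tsum_of_dominated_convergence h0 (fun B => ?_) (Eventually.of_forall fun n B => ?_)
  · refine tendsto_const_nhds.congr' ?_
    by_cases hB : v ∈ B ∧ J.coupling B ≠ 0
    · obtain ⟨n, hn⟩ : ∃ n, B ⊆ D.seq n := by
        have h2 : ∀ u ∈ B, ∃ k, u ∈ D.seq k := fun u hu => by
          simpa using D.cover B hB.1 hB.2 hu
        choose! k hk using h2
        exact ⟨B.sup k, fun u hu => seq_mono D (Finset.le_sup hu) (hk u hu)⟩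
      filter_upwards [eventually_ge_atTop n] with m hm
      rw [Set.indicator_of_notMem]
      exact fun h => h.2 (hn.trans (seq_mono D hm))
    · refine Eventually.of_forall fun n => ?_
      by_cases hm : B ∈ beyond v (D.seq n)
      · have hz : J.coupling B = 0 := by
          by_contra h3
          exact hB ⟨hm.1, h3⟩
        simp [Set.indicator, hz]
      · exact (Set.indicator_of_notMem hm _).symm
  · rw [Real.norm_of_nonneg (Set.indicator_nonneg (fun _ _ => abs_nonneg _) _)]
    exact Set.indicator_le_indicator_of_subset (beyond_subset _ _) (fun _ => abs_nonneg _) B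

lemma hasSum_lam (J : Interaction d) {v : Vertex d} (D : J.Growth v) :
    HasSum (J.lam v D.seq) 1 := by
  rw [hasSum_iff_tendsto_nat_of_nonneg (J.lam_nonneg D), ← tendsto_add_atTop_iff_nat 2]
  simp only [sum_lam]
  have h := (J.tendsto_absSum_beyond D).comp (tendsto_add_atTop_nat 1)
  simpa [Function.comp_def] using (Real.continuous_exp.tendsto _).comp h.neg

/-! ### The backward sketch procedure -/

/-- The law of the selected vertex: `w ∈ C` has probability `M_w / ∑_{z ∈ C} M_z`. -/
noncomputable def vertexLaw (J : Interaction d) (C : Finset (Vertex d)) (hC : C.Nonempty) :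
    PMF (Vertex d) :=
  PMF.ofFinset (fun w => if w ∈ C then ENNReal.ofReal (J.mass w / ∑ z ∈ C, J.mass z) else 0) C
    (by
      have hpos : 0 < ∑ z ∈ C, J.mass z := Finset.sum_pos (fun z _ => J.mass_pos z) hC
      rw [Finset.sum_congr rfl fun w hw => if_pos hw, ← ENNReal.ofReal_sum_of_nonneg
        (fun w _ => div_nonneg (J.mass_pos w).le hpos.le), ← Finset.sum_div, div_self hpos.ne',
        ENNReal.ofReal_one])
    (fun w hw => if_neg hw)

/-- The probability distribution `λ_v` on `ℕ`. -/
noncomputable def lamLaw (J : Interaction d) {v : Vertex d} (D : J.Growth v) : PMF ℕ :=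
  ⟨fun k => ENNReal.ofReal (J.lam v D.seq k), by
    have h := J.hasSum_lam D
    have h2 := ENNReal.ofReal_tsum_of_nonneg (J.lam_nonneg D) h.summable
    rw [h.tsum_eq, ENNReal.ofReal_one] at h2
    rw [h2]
    exact ENNReal.summable.hasSum⟩

end Interaction

/-- A record of the draws `(w, k)` made by the backward sketch procedure, in chronological
order. -/
def Sketch (d : ℕ) := List (Vertex d × ℕ)

instance (d : ℕ) : MeasurableSpace (Sketch d) := ⊤

instance (d : ℕ) : DiscreteMeasurableSpace (Sketch d) := ⟨fun _ => trivial⟩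

instance (d : ℕ) : Countable (Sketch d) := inferInstanceAs (Countable (List (Vertex d × ℕ)))

namespace Interaction

variable {d : ℕ}

/-- The effect of the draw `(w, k)` on the current set `C`: remove `w` if `k = 0`, and otherwise
add the points of `B_w(k)`. -/
def advance {J : Interaction d} (B : ∀ v, J.Growth v) (C : Finset (Vertex d))
    (wk : Vertex d × ℕ) : Finset (Vertex d) :=
  if wk.2 = 0 then C.erase wk.1 else C ∪ (B wk.1).seq wk.2

/-- The set reached from `C₀` after the draws recorded in `l`. -/
def clan {J : Interaction d} (B : ∀ v, J.Growth v) (C₀ : Finset (Vertex d))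
    (l : Sketch d) : Finset (Vertex d) :=
  List.foldl (advance B) C₀ l

open Classical in
/-- One step of the backward sketch procedure: if the current set `C` is empty nothing happens;
otherwise a vertex `w ∈ C` is selected proportionally to its mass, then `k` is drawn from `λ_w`,
and `(w, k)` is appended to the record. -/
noncomputable def sketchStep {J : Interaction d} (B : ∀ v, J.Growth v) (C₀ : Finset (Vertex d))
    (l : Sketch d) : PMF (Sketch d) :=
  if h : (clan B C₀ l).Nonempty then
    (J.vertexLaw (clan B C₀ l) h).bind fun w =>
      (J.lamLaw (B w)).map fun k => List.append l [(w, k)]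
  else PMF.pure l

/-- The transition kernel of the backward sketch procedure. -/
noncomputable def sketchKernel {J : Interaction d} (B : ∀ v, J.Growth v)
    (C₀ : Finset (Vertex d)) : Kernel (Sketch d) (Sketch d) :=
  Kernel.ofFunOfCountable fun l => (sketchStep B C₀ l).toMeasure

instance {J : Interaction d} (B : ∀ v, J.Growth v) (C₀ : Finset (Vertex d)) :
    IsMarkovKernel (sketchKernel B C₀) :=
  ⟨fun l => PMF.toMeasure.isProbabilityMeasure (sketchStep B C₀ l)⟩

/-- The law of the trajectory of the backward sketch procedure started from `C₀`: the homogeneous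
Markov chain with kernel `sketchKernel` and empty initial record. -/
noncomputable def sketchMeasure {J : Interaction d} (B : ∀ v, J.Growth v)
    (C₀ : Finset (Vertex d)) : Measure (ℕ → Sketch d) :=
  Kernel.trajMeasure (X := fun _ => Sketch d) (Measure.dirac ([] : List (Vertex d × ℕ)))
    fun n => (sketchKernel B C₀).comap
      (fun h : (i : Finset.Iic n) → Sketch d => h ⟨n, Finset.mem_Iic.mpr le_rfl⟩)
      (measurable_pi_apply _)

/-- The backward sketch process `C_n`. -/
def sketchProcess {J : Interaction d} (B : ∀ v, J.Growth v) (C₀ : Finset (Vertex d)) (n : ℕ)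
    (ω : ℕ → Sketch d) : Finset (Vertex d) :=
  clan B C₀ (ω n)

/-- The probability that the backward sketch procedure stops with the record `l`. -/
noncomputable def stopProb {J : Interaction d} (B : ∀ v, J.Growth v) (C₀ : Finset (Vertex d))
    (l : Sketch d) : ℝ≥0∞ :=
  sketchMeasure B C₀ {ω | ∃ n, ω n = l ∧ sketchProcess B C₀ n ω = ∅}

/-! ### The forward spin procedure -/

/-- The law `p_v^{[k]}(· | σ)` of the new spin at `v`. -/
noncomputable def spinLaw {J : Interaction d} (B : ∀ v, J.Growth v) (v : Vertex d) (k : ℕ)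
    (σ : Config d) : PMF ℤˣ :=
  PMF.ofFintype (fun a => ENNReal.ofReal (J.updateProb v (B v).seq k σ a)) (by
    rw [← ENNReal.ofReal_sum_of_nonneg fun a _ => J.updateProb_nonneg v (B v).seq k σ a,
      J.sum_updateProb, ENNReal.ofReal_one])

/-- The forward spin procedure: the draws of the sketch are processed from the last one back to
the first one, the draw `(w, k)` replacing the spin at `w` by a spin with law
`p_w^{[k]}(· | σ)`. The reference configuration `σ₀` only gives formal values to spins that have
not been assigned yet. -/
noncomputable def forward {J : Interaction d} (B : ∀ v, J.Growth v) (σ₀ : Config d) :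
    List (Vertex d × ℕ) → PMF (Config d)
  | [] => PMF.pure σ₀
  | (w, k) :: l => (forward B σ₀ l).bind fun σ =>
      (spinLaw B w k σ).map fun a => Function.update σ w a

/-- The law of the output of the perfect simulation algorithm with observation window `C₀`
(a measure of total mass at most `1`: runs that never stop give no output). -/
noncomputable def outputLaw {J : Interaction d} (B : ∀ v, J.Growth v) (C₀ : Finset (Vertex d))
    (σ₀ : Config d) : Measure (Config d) :=
  Measure.sum fun l : Sketch d => stopProb B C₀ l • (forward B σ₀ l).toMeasure

end Interaction

/-!
The argument rests on a duality between the backward sketch and the single-site spin-flip dynamics.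

* The weights are chosen so that `∑ₖ λ_v(k) p_v^{[k]}(-σ(v) | σ) = e^{-E_v(σ)} / M_v`, where
  `E_v(σ) = ∑_{B ∋ v} J_B χ_B(σ)`: the sum telescopes (`sum_lam_mul_flipProb`,
  `hasSum_lam_mul_flipProb`). The resulting flip probability satisfies detailed balance with respect
  to every Gibbs measure (`IsGibbs.lintegral_flipRate_flip`), so that updating one site, with `k`
  drawn from `λ_v`, preserves every Gibbs measure `π` (`IsGibbs.lintegral_tsum_lamLaw`).
* For a record `l` of draws let `Φ(l)` be the `π`-probability of an event in the window `C₀` after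
  the forward procedure driven by `l` and started from a configuration with law `π`. The last draw
  of the record is the first one to be executed, and the choice of the vertex does not depend on
  the spins; by the invariance above, `Φ` is harmonic for the chain of records
  (`IsGibbs.lintegral_outputProb_harmonic`). Once the sketch has died out, the output on `C₀` no
  longer depends on the initial configuration (`forward_map_restrict_congr`). Hence, if the sketch
  dies out almost surely, the output has the law of `π` on `C₀`
  (`IsGibbs.outputLaw_map_restrict`). This also gives the uniqueness of `π`.
* Extinction under (H2) follows from a Foster-Lyapunov argument with a concave function of the
  cardinality (`potential`). Outside a finite set the mean number of offspring is at most `r < 1`,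
  and the masses `M_v` are bounded above and below, so that in a large set the mean drift is
  negative. In a small set the increments of the function decrease geometrically, so fast that the
  deaths, which have a probability bounded below, outweigh the births
  (`ConditionH2For.exists_potential`).
* A Gibbs measure exists by compactness: the finite-volume measures satisfy the Gibbs property at
  the sites of the box, and this property is tested against continuous functions (`exists_isGibbs`).
* (H1) is (H2) for the balls, uniformly in `v`. In the other direction, for the translation-invariant
  pair interaction along bonds `{u, u + 5 e_i}` the adapted sets `{v, v ± 5 e_i}` have only three
  points, while the first ball that captures the interaction has at least eleven
  (`exists_conditionH2_not_conditionH1`).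
-/

instance : DiscreteMeasurableSpace ℤˣ := by
  have : MeasurableSingletonClass ℤˣ := ⟨fun u => ⟨{(u : ℤ)}, MeasurableSet.singleton _, by
    ext x; simp [Units.ext_iff]⟩⟩
  infer_instance

instance : BorelSpace ℤˣ := ⟨by
  rw [borel_eq_top_of_discrete]
  ext s; simp [MeasurableSet.of_discrete]⟩

namespace Interaction

variable {d : ℕ}

/-! ### One-site conditional laws -/

/-- The spins at the vertices other than `v`. -/
def out (v : Vertex d) (σ : Config d) : {u : Vertex d // u ≠ v} → ℤˣ := fun u => σ u

open Classical in
/-- The configuration with spin `a` at `v` and spins `τ` elsewhere. -/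
noncomputable def ins (v : Vertex d) (a : ℤˣ) (τ : {u : Vertex d // u ≠ v} → ℤˣ) : Config d :=
  fun u => if h : u = v then a else τ ⟨u, h⟩

lemma continuous_out (v : Vertex d) : Continuous (out v) :=
  continuous_pi fun u => continuous_apply u.1

lemma measurable_out (v : Vertex d) : Measurable (out v) :=
  measurable_pi_lambda _ fun u => measurable_pi_apply u.1

lemma continuous_ins (v : Vertex d) (a : ℤˣ) : Continuous (ins v a) := by
  refine continuous_pi fun u => ?_
  by_cases h : u = v
  · simpa [ins, h] using continuous_const
  · simpa [ins, h] using continuous_apply _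

lemma measurable_ins (v : Vertex d) (a : ℤˣ) : Measurable (ins v a) := by
  refine measurable_pi_lambda _ fun u => ?_
  by_cases h : u = v
  · simp [ins, h]
  · simpa [ins, h] using measurable_pi_apply _

lemma ins_out (v : Vertex d) (a : ℤˣ) (σ : Config d) :
    ins v a (out v σ) = Function.update σ v a := by
  funext u
  by_cases h : u = v
  · subst h; simp [ins]
  · simp [ins, out, h]

lemma out_update (v : Vertex d) (a : ℤˣ) (σ : Config d) :
    out v (Function.update σ v a) = out v σ := by
  funext u
  simp [out, u.2]

/-- The energy `∑_{B ∋ v} J_B χ_B(σ)` at the site `v`. -/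
noncomputable def siteEnergy (J : Interaction d) (v : Vertex d) (σ : Config d) : ℝ :=
  J.spinSum (star v) σ

lemma continuous_chi (B : Finset (Vertex d)) : Continuous (chi B) := by
  unfold chi
  refine continuous_finsetProd _ fun u _ => ?_
  exact (continuous_of_discreteTopology (f := fun x : ℤˣ => ((x : ℤ) : ℝ))).comp (continuous_apply u)

lemma continuous_spinSum (J : Interaction d) {𝒜 : Set (Finset (Vertex d))}
    (h : Summable fun B : 𝒜 => |J.coupling B|) : Continuous (J.spinSum 𝒜) := by
  unfold spinSum
  refine continuous_tsum (fun B => continuous_const.mul (continuous_chi _)) h fun B σ => ?_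
  rw [Real.norm_eq_abs, abs_mul, abs_chi, mul_one]

lemma continuous_siteEnergy (J : Interaction d) (v : Vertex d) : Continuous (J.siteEnergy v) :=
  J.continuous_spinSum (J.summable_star v)

lemma chi_update_neg {v : Vertex d} {B : Finset (Vertex d)} (h : v ∈ B) (σ : Config d) (a : ℤˣ) :
    chi B (Function.update σ v (-a)) = -chi B (Function.update σ v a) := by
  unfold chi
  rw [← Finset.mul_prod_erase B _ h, ← Finset.mul_prod_erase B _ h]
  simp only [Function.update_self, Units.val_neg, Int.cast_neg, neg_mul]
  congr 2
  refine Finset.prod_congr rfl fun u hu => ?_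
  simp [Finset.ne_of_mem_erase hu]

lemma siteEnergy_update_neg (J : Interaction d) (v : Vertex d) (σ : Config d) (a : ℤˣ) :
    J.siteEnergy v (Function.update σ v (-a)) = -J.siteEnergy v (Function.update σ v a) := by
  unfold siteEnergy spinSum
  rw [← tsum_neg]
  refine tsum_congr fun B => ?_
  rw [chi_update_neg B.2, mul_neg]

/-- The conditional probability of the spin `a` at `v` under a Gibbs measure, as a function of the
configuration. -/
noncomputable def siteProb (J : Interaction d) (v : Vertex d) (a : ℤˣ) (σ : Config d) : ℝ :=
  1 / (1 + Real.exp (-2 * J.siteEnergy v (Function.update σ v a)))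

lemma siteProb_nonneg (J : Interaction d) (v : Vertex d) (a : ℤˣ) (σ : Config d) :
    0 ≤ J.siteProb v a σ := by
  unfold siteProb; positivity

lemma siteProb_le_one (J : Interaction d) (v : Vertex d) (a : ℤˣ) (σ : Config d) :
    J.siteProb v a σ ≤ 1 := by
  unfold siteProb
  rw [div_le_one (by positivity)]
  linarith [Real.exp_pos (-2 * J.siteEnergy v (Function.update σ v a))]

lemma siteProb_eq_comp_out (J : Interaction d) (v : Vertex d) (a : ℤˣ) :
    J.siteProb v a =
      (fun τ => 1 / (1 + Real.exp (-2 * J.siteEnergy v (ins v a τ)))) ∘ out v := by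
  funext σ
  simp [siteProb, ins_out]

lemma continuous_siteProb_ins (J : Interaction d) (v : Vertex d) (a : ℤˣ) :
    Continuous (fun τ => 1 / (1 + Real.exp (-2 * J.siteEnergy v (ins v a τ)))) := by
  have := (J.continuous_siteEnergy v).comp (continuous_ins v a)
  refine Continuous.div continuous_const (by fun_prop) fun τ => ?_
  positivity

lemma continuous_siteProb (J : Interaction d) (v : Vertex d) (a : ℤˣ) :
    Continuous (J.siteProb v a) := by
  rw [siteProb_eq_comp_out]
  exact (J.continuous_siteProb_ins v a).comp (continuous_out v)

lemma integrable_siteProb (J : Interaction d) (v : Vertex d) (a : ℤˣ) (π : Measure (Config d))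
    [IsFiniteMeasure π] : Integrable (J.siteProb v a) π := by
  refine Integrable.of_bound (J.continuous_siteProb v a).measurable.aestronglyMeasurable 1
    (ae_of_all _ fun σ => ?_)
  rw [Real.norm_eq_abs, abs_of_nonneg (J.siteProb_nonneg v a σ)]
  exact J.siteProb_le_one v a σ

lemma measurableSet_spin_eq (v : Vertex d) (a : ℤˣ) : MeasurableSet {σ : Config d | σ v = a} :=
  measurableSet_eq_fun (measurable_pi_apply v) measurable_const

lemma outside_le (v : Vertex d) : outside v ≤ (MeasurableSpace.pi : MeasurableSpace (Config d)) :=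
  (measurable_out v).comap_le

/-- The Gibbs property at `v`, written without conditional expectations: on the event `σ(v) = a`
the spins outside `v` have density `siteProb v a` with respect to their unrestricted law. -/
lemma isGibbs_iff (J : Interaction d) (π : Measure (Config d)) :
    J.IsGibbs π ↔ IsProbabilityMeasure π ∧ ∀ (v : Vertex d) (a : ℤˣ),
      (π.restrict {σ | σ v = a}).map (out v) =
        (π.withDensity fun σ => ENNReal.ofReal (J.siteProb v a σ)).map (out v) := by
  unfold IsGibbs
  refine and_congr_right fun hπ => forall_congr' fun v => forall_congr' fun a => ?_
  change π[({σ : Config d | σ v = a}).indicator (fun _ => (1 : ℝ)) | outside v] =ᵐ[π]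
    J.siteProb v a ↔ _
  have hmA := measurableSet_spin_eq v a
  have hint : Integrable (({σ : Config d | σ v = a}).indicator (fun _ => (1 : ℝ))) π :=
    (integrable_const _).indicator hmA
  have key : ∀ T : Set ({u : Vertex d // u ≠ v} → ℤˣ), MeasurableSet T →
      ((π.restrict {σ | σ v = a}).map (out v) T =
        ENNReal.ofReal (∫ σ in out v ⁻¹' T, ({σ : Config d | σ v = a}).indicator
          (fun _ => (1 : ℝ)) σ ∂π)) ∧
      ((π.withDensity fun σ => ENNReal.ofReal (J.siteProb v a σ)).map (out v) T =
        ENNReal.ofReal (∫ σ in out v ⁻¹' T, J.siteProb v a σ ∂π)) := by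
    intro T hT
    have hT' := measurable_out v hT
    rw [Measure.map_apply (measurable_out v) hT, Measure.map_apply (measurable_out v) hT,
      Measure.restrict_apply hT', withDensity_apply _ hT']
    constructor
    · rw [integral_indicator hmA, Measure.restrict_restrict hmA]
      simp [Measure.real, Set.inter_comm]
    · rw [ofReal_integral_eq_lintegral_ofReal (J.integrable_siteProb v a π).integrableOn
        (ae_of_all _ fun σ => J.siteProb_nonneg v a σ)]
  constructor
  · intro h
    refine Measure.ext fun T hT => ?_
    rw [(key T hT).1, (key T hT).2]
    congr 1
    exact (setIntegral_condExp (outside_le v) hint ⟨T, hT, rfl⟩).symm.trans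
      (integral_congr_ae (ae_restrict_of_ae h))
  · intro h
    refine (ae_eq_condExp_of_forall_setIntegral_eq (outside_le v) hint
      (fun s _ _ => (J.integrable_siteProb v a π).integrableOn) ?_ ?_).symm
    · rintro s ⟨T, hT, rfl⟩ -
      have h1 := DFunLike.congr_fun h T
      rw [(key T hT).1, (key T hT).2] at h1
      rw [ENNReal.ofReal_eq_ofReal_iff] at h1
      · exact h1.symm
      · exact setIntegral_nonneg (measurable_out v hT) fun σ _ =>
          Set.indicator_nonneg (fun _ _ => zero_le_one) σ
      · exact setIntegral_nonneg (measurable_out v hT) fun σ _ => J.siteProb_nonneg v a σ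
    · rw [siteProb_eq_comp_out]
      refine Measurable.aestronglyMeasurable ?_
      exact (J.continuous_siteProb_ins v a).measurable.comp (comap_measurable _)

lemma IsGibbs.setLIntegral_eq {J : Interaction d} {π : Measure (Config d)} (hπ : J.IsGibbs π)
    (v : Vertex d) (a : ℤˣ) {h : Config d → ℝ≥0∞} (hh : Measurable h) :
    ∫⁻ σ in {σ | σ v = a}, h σ ∂π =
      ∫⁻ σ, ENNReal.ofReal (J.siteProb v a σ) * h (Function.update σ v a) ∂π := by
  have h1 := ((J.isGibbs_iff π).mp hπ).2 v a
  have h2 : ∫⁻ σ in {σ | σ v = a}, h σ ∂π = ∫⁻ σ in {σ | σ v = a}, h (ins v a (out v σ)) ∂π := by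
    refine setLIntegral_congr_fun (measurableSet_spin_eq v a) fun σ hσ => ?_
    have : σ v = a := hσ
    simp only [ins_out, ← this, Function.update_eq_self]
  have hm : Measurable fun τ => h (ins v a τ) := hh.comp (measurable_ins v a)
  rw [h2, ← lintegral_map (f := fun τ => h (ins v a τ)) hm (measurable_out v), h1,
    lintegral_map hm (measurable_out v),
    lintegral_withDensity_eq_lintegral_mul (g := fun σ => h (ins v a (out v σ))) _
      (J.continuous_siteProb v a).measurable.ennreal_ofReal (hm.comp (measurable_out v))]
  simp [ins_out]

/-- The flip rate at `v`, normalized by the mass `M_v`. -/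
noncomputable def flipRate (J : Interaction d) (v : Vertex d) (σ : Config d) : ℝ :=
  Real.exp (-J.siteEnergy v σ) / J.mass v

lemma flipRate_nonneg (J : Interaction d) (v : Vertex d) (σ : Config d) : 0 ≤ J.flipRate v σ :=
  div_nonneg (Real.exp_pos _).le (J.mass_pos v).le

lemma flipRate_le_one (J : Interaction d) (v : Vertex d) (σ : Config d) : J.flipRate v σ ≤ 1 := by
  unfold flipRate
  rw [div_le_one (J.mass_pos v), mass]
  have h := abs_le.mp (J.abs_spinSum_le (v := v) subset_rfl σ)
  have h2 : Real.exp (-J.siteEnergy v σ) ≤ Real.exp (J.absSum (star v)) :=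
    Real.exp_le_exp.mpr (by unfold siteEnergy; linarith)
  linarith [Real.exp_pos (J.absSum (star v))]

lemma measurable_flipRate (J : Interaction d) (v : Vertex d) : Measurable (J.flipRate v) :=
  (Real.continuous_exp.measurable.comp (J.continuous_siteEnergy v).measurable.neg).div_const _

/-- The configuration with the spin at `v` flipped. -/
def flip (v : Vertex d) (σ : Config d) : Config d := Function.update σ v (-σ v)

lemma measurable_flip (v : Vertex d) : Measurable (flip v) :=
  measurable_pi_lambda _ fun u => by
    by_cases h : u = v
    · subst h
      simpa [flip, Function.comp_def] using
        (Measurable.of_discrete (f := fun x : ℤˣ => -x)).comp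
          (measurable_pi_apply u : Measurable fun σ : Config d => σ u)
    · simpa [flip, h] using measurable_pi_apply u

lemma lintegral_eq_sum_spin (π : Measure (Config d)) (v : Vertex d) (h : Config d → ℝ≥0∞) :
    ∫⁻ σ, h σ ∂π = ∫⁻ σ in {σ | σ v = 1}, h σ ∂π + ∫⁻ σ in {σ | σ v = -1}, h σ ∂π := by
  rw [← lintegral_add_compl h (measurableSet_spin_eq v 1)]
  congr 3
  ext σ
  rcases Int.units_eq_one_or (σ v) with h | h <;> simp [h]

/-- Detailed balance of the spin-flip dynamics. -/
lemma IsGibbs.lintegral_flipRate_flip {J : Interaction d} {π : Measure (Config d)}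
    (hπ : J.IsGibbs π) (v : Vertex d) {h : Config d → ℝ≥0∞} (hh : Measurable h) :
    ∫⁻ σ, ENNReal.ofReal (J.flipRate v σ) * h (flip v σ) ∂π =
      ∫⁻ σ, ENNReal.ofReal (J.flipRate v σ) * h σ ∂π := by
  have hm := (J.measurable_flipRate v).ennreal_ofReal
  have hbal : ∀ (σ : Config d) (a : ℤˣ),
      J.siteProb v a σ * J.flipRate v (Function.update σ v a) =
        J.siteProb v (-a) σ * J.flipRate v (Function.update σ v (-a)) := by
    intro σ a
    unfold siteProb flipRate
    rw [siteEnergy_update_neg]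
    set E := J.siteEnergy v (Function.update σ v a)
    have hM := (J.mass_pos v).ne'
    have e1 : Real.exp (-2 * E) = Real.exp (-E) * Real.exp (-E) := by rw [← Real.exp_add]; ring_nf
    have e2 : Real.exp (-2 * -E) = Real.exp E * Real.exp E := by rw [← Real.exp_add]; ring_nf
    have e3 : Real.exp (-E) * Real.exp E = 1 := by rw [← Real.exp_add]; simp
    have p1 : 0 < 1 + Real.exp (-2 * E) := by positivity
    have p2 : 0 < 1 + Real.exp (-2 * -E) := by positivity
    rw [neg_neg]
    rw [e1] at p1 ⊢
    rw [e2] at p2 ⊢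
    field_simp
    linear_combination (Real.exp E - Real.exp (-E)) * e3
  have side : ∀ a : ℤˣ, ∫⁻ σ in {σ | σ v = a}, ENNReal.ofReal (J.flipRate v σ) * h (flip v σ) ∂π =
      ∫⁻ σ in {σ | σ v = -a}, ENNReal.ofReal (J.flipRate v σ) * h σ ∂π := by
    intro a
    rw [hπ.setLIntegral_eq v a (h := fun σ => ENNReal.ofReal (J.flipRate v σ) * h (flip v σ))
        (hm.mul (hh.comp (measurable_flip v))),
      hπ.setLIntegral_eq v (-a) (h := fun σ => ENNReal.ofReal (J.flipRate v σ) * h σ) (hm.mul hh)]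
    refine lintegral_congr fun σ => ?_
    simp only [← mul_assoc]
    rw [← ENNReal.ofReal_mul (J.siteProb_nonneg _ _ _), ← ENNReal.ofReal_mul (J.siteProb_nonneg _ _ _),
      hbal σ a]
    simp [flip]
  rw [lintegral_eq_sum_spin π v, lintegral_eq_sum_spin π v (fun σ => _ * h σ), side, side, neg_neg,
    add_comm]

/-! ### Decomposition of the flip rate -/

lemma summable_mul_chi (J : Interaction d) {𝒜 : Set (Finset (Vertex d))}
    (h : Summable fun B : 𝒜 => |J.coupling B|) (σ : Config d) :
    Summable fun B : 𝒜 => J.coupling B * chi B σ :=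
  Summable.of_norm <| by simpa [Real.norm_eq_abs, abs_mul, abs_chi] using h

lemma spinSum_union (J : Interaction d) {𝒜 𝒜' : Set (Finset (Vertex d))}
    (h : Summable fun B : 𝒜 => |J.coupling B|) (h' : Summable fun B : 𝒜' => |J.coupling B|)
    (hd : Disjoint 𝒜 𝒜') (σ : Config d) :
    J.spinSum (𝒜 ∪ 𝒜') σ = J.spinSum 𝒜 σ + J.spinSum 𝒜' σ :=
  Summable.tsum_union_disjoint (f := fun B => J.coupling B * chi B σ) hd
    (J.summable_mul_chi h σ) (J.summable_mul_chi h' σ)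

lemma spinSum_within_add_beyond (J : Interaction d) (v : Vertex d) (D : Finset (Vertex d))
    (σ : Config d) :
    J.spinSum (within v D) σ + J.spinSum (beyond v D) σ = J.siteEnergy v σ := by
  rw [← J.spinSum_union (J.summable_of_subset (within_subset v D))
    (J.summable_of_subset (beyond_subset v D)), siteEnergy]
  · congr 1
    ext B
    simp only [within, beyond, star, Set.mem_union, Set.mem_ofPred_eq]
    tauto
  · rw [Set.disjoint_left]
    exact fun B h h' => h'.2 h.2

lemma within_eq_union_shell (v : Vertex d) {D D' : Finset (Vertex d)} (h : D ⊆ D') :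
    within v D' = within v D ∪ shell v D' D := by
  ext B
  simp only [within, shell, Set.mem_union, Set.mem_ofPred_eq]
  by_cases hB : B ⊆ D
  · simp [hB, hB.trans h]
  · simp [hB]

lemma disjoint_within_shell (v : Vertex d) (D D' : Finset (Vertex d)) :
    Disjoint (within v D) (shell v D' D) := by
  rw [Set.disjoint_left]
  exact fun B h h' => h'.2.2 h.2

lemma tendsto_spinSum_within (J : Interaction d) {v : Vertex d} (D : J.Growth v) (σ : Config d) :
    Tendsto (fun n => J.spinSum (within v (D.seq n)) σ) atTop (𝓝 (J.siteEnergy v σ)) := by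
  rw [tendsto_iff_norm_sub_tendsto_zero]
  refine squeeze_zero (fun _ => norm_nonneg _) (fun n => ?_) (J.tendsto_absSum_beyond D)
  rw [← J.spinSum_within_add_beyond v (D.seq n) σ, Real.norm_eq_abs, sub_add_cancel_left, abs_neg]
  exact J.abs_spinSum_le (beyond_subset _ _) σ

/-- The partial sums of the decomposition telescope: up to the scale `n + 1`, the interactions
reaching beyond `B_v(n + 1)` are replaced by the worst case. -/
lemma sum_lam_mul_flipProb (J : Interaction d) {v : Vertex d} (D : J.Growth v) (σ : Config d)
    (n : ℕ) :
    ∑ k ∈ Finset.range (n + 2), J.lam v D.seq k * J.flipProb v D.seq k σ =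
      Real.exp (-J.spinSum (within v (D.seq (n + 1))) σ - J.absSum (beyond v (D.seq (n + 1)))) /
        J.mass v := by
  have hM := (J.mass_pos v).ne'
  induction n with
  | zero =>
    simp only [Finset.sum_range_succ, Finset.sum_range_zero, zero_add, lam, flipProb]
    set s := J.absSum (within v (D.seq 1)) with hs
    set t := J.absSum (beyond v (D.seq 1)) with ht
    set e := J.spinSum (within v (D.seq 1)) σ with he
    have hst : J.absSum (star v) = s + t := (J.absSum_within_add_beyond v _).symm
    have he' := abs_le.mp (show |e| ≤ s from J.abs_spinSum_le (within_subset _ _) σ)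
    have hs0 : 0 ≤ s := J.absSum_nonneg _
    have ht0 : 0 ≤ t := J.absSum_nonneg _
    have hMe : J.mass v = 2 * (Real.exp s * Real.exp t) := by rw [mass, hst, Real.exp_add]
    have h1 : Real.exp (-2 * J.absSum (star v)) * (1 / 2) =
        Real.exp (-s) * Real.exp (-t) / J.mass v := by
      rw [eq_div_iff hM, hMe, hst, show -2 * (s + t) = -s + -s + (-t + -t) by ring]
      simp only [Real.exp_add]
      have a1 : Real.exp (-s) * Real.exp s = 1 := by rw [← Real.exp_add]; simp
      have a2 : Real.exp (-t) * Real.exp t = 1 := by rw [← Real.exp_add]; simp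
      linear_combination Real.exp (-s) * Real.exp (-t) * Real.exp (-t) * Real.exp t * a1 +
        Real.exp (-s) * Real.exp (-t) * a2
    have h2 : (Real.exp (-t) - Real.exp (-2 * J.absSum (star v))) * (1 / J.mass v *
        ((Real.exp (-e) - Real.exp (-s)) / (1 - Real.exp (-2 * s) * Real.exp (-t)))) =
        Real.exp (-t) * (Real.exp (-e) - Real.exp (-s)) / J.mass v := by
      have h3 : Real.exp (-t) - Real.exp (-2 * J.absSum (star v)) =
          Real.exp (-t) * (1 - Real.exp (-2 * s) * Real.exp (-t)) := by
        rw [hst, mul_sub, mul_one, ← Real.exp_add, ← Real.exp_add]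
        ring_nf
      rw [h3]
      by_cases h0 : 1 - Real.exp (-2 * s) * Real.exp (-t) = 0
      · -- The denominator vanishes only when `s = t = 0`, and then so does the numerator.
        have h4 : -2 * s + -t = 0 := by
          rw [← Real.exp_eq_one_iff, Real.exp_add]; linarith
        have h5 : s = 0 := by linarith
        have h6 : e = 0 := by linarith
        simp [h5, h6]
      · rw [one_div_mul_eq_div, mul_assoc, mul_div_assoc', mul_div_cancel₀ _ h0, mul_div_assoc']
    rw [h1, h2, ← add_div, sub_eq_add_neg (-e) t, Real.exp_add (-e)]
    congr 1
    ring
  | succ n ih =>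
    rw [Finset.sum_range_succ, ih]
    simp only [lam, flipProb]
    set s := J.absSum (shell v (D.seq (n + 2)) (D.seq (n + 1))) with hs
    set t := J.absSum (beyond v (D.seq (n + 2))) with ht
    set f := J.spinSum (within v (D.seq (n + 1))) σ with hf
    set e := J.spinSum (shell v (D.seq (n + 2)) (D.seq (n + 1))) σ with he
    have hsub : D.seq (n + 1) ⊆ D.seq (n + 2) := (D.seq_succ _).1
    have hw := within_eq_union_shell v hsub
    have h1 : J.spinSum (within v (D.seq (n + 1 + 1))) σ = f + e := by
      rw [hw, J.spinSum_union (J.summable_of_subset (within_subset _ _))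
        (J.summable_of_subset (shell_subset _ _ _)) (disjoint_within_shell _ _ _)]
    have h2 : J.absSum (beyond v (D.seq (n + 1))) = t + s := by
      have a1 := J.absSum_within_add_beyond v (D.seq (n + 1))
      have a2 := J.absSum_within_add_beyond v (D.seq (n + 2))
      rw [hw, J.absSum_union (within_subset _ _) (shell_subset _ _ _)
        (disjoint_within_shell _ _ _)] at a2
      linarith
    have he' := abs_le.mp (show |e| ≤ s from J.abs_spinSum_le (shell_subset _ _ _) σ)
    rw [h1, h2]
    have h3 : (Real.exp (-t) - Real.exp (-(t + s))) * (Real.exp (-f) / J.mass v *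
        ((Real.exp (-e) - Real.exp (-s)) / (1 - Real.exp (-s)))) =
        Real.exp (-t) * Real.exp (-f) * (Real.exp (-e) - Real.exp (-s)) / J.mass v := by
      have h4 : Real.exp (-t) - Real.exp (-(t + s)) = Real.exp (-t) * (1 - Real.exp (-s)) := by
        rw [mul_sub, mul_one, ← Real.exp_add]; ring_nf
      rw [h4]
      by_cases h0 : 1 - Real.exp (-s) = 0
      · have h5 : -s = 0 := by rw [← Real.exp_eq_one_iff]; linarith
        have h6 : s = 0 := by linarith
        have h7 : e = 0 := by linarith
        simp [h6, h7]
      · field_simp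
    rw [h3, ← add_div]
    congr 1
    rw [show -f - (t + s) = -f + -t + -s by ring, show -(f + e) - t = -f + -t + -e by ring]
    simp only [Real.exp_add]
    ring

/-- The update laws `p_v^{[k]}`, mixed with the weights `λ_v(k)`, flip the spin at `v` with
probability `flipRate`. -/
lemma hasSum_lam_mul_flipProb (J : Interaction d) {v : Vertex d} (D : J.Growth v) (σ : Config d) :
    HasSum (fun k => J.lam v D.seq k * J.flipProb v D.seq k σ) (J.flipRate v σ) := by
  rw [hasSum_iff_tendsto_nat_of_nonneg
    (fun k => mul_nonneg (J.lam_nonneg D k) (J.flipProb_mem v D.seq k σ).1),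
    ← tendsto_add_atTop_iff_nat 2]
  simp only [sum_lam_mul_flipProb]
  have h := ((J.tendsto_spinSum_within D σ).neg.sub (J.tendsto_absSum_beyond D)).comp
    (tendsto_add_atTop_nat 1)
  have h2 := ((Real.continuous_exp.tendsto _).comp h).div_const (J.mass v)
  simpa [flipRate, Function.comp_def] using h2

lemma sum_spinLaw {J : Interaction d} (B : ∀ v, J.Growth v) (w : Vertex d) (k : ℕ) (σ : Config d)
    (h : Config d → ℝ≥0∞) :
    ∑ a, spinLaw B w k σ a * h (Function.update σ w a) =
      ENNReal.ofReal (J.flipProb w (B w).seq k σ) * h (flip w σ) +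
        ENNReal.ofReal (1 - J.flipProb w (B w).seq k σ) * h σ := by
  have hu : (Finset.univ : Finset ℤˣ) = {-σ w, σ w} := by
    rcases Int.units_eq_one_or (σ w) with h | h <;> rw [h] <;> decide
  have hne : -σ w ≠ σ w := by
    rcases Int.units_eq_one_or (σ w) with h | h <;> rw [h] <;> decide
  rw [hu, Finset.sum_pair hne]
  simp [spinLaw, updateProb, flip, hne.symm]

/-- Averaging the updates over the law `λ_w` of `k` gives the one-site spin-flip kernel. -/
lemma tsum_lamLaw_mul_sum_spinLaw {J : Interaction d} (B : ∀ v, J.Growth v) (w : Vertex d)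
    (σ : Config d) (h : Config d → ℝ≥0∞) :
    ∑' k, J.lamLaw (B w) k * ∑ a, spinLaw B w k σ a * h (Function.update σ w a) =
      ENNReal.ofReal (J.flipRate w σ) * h (flip w σ) +
        ENNReal.ofReal (1 - J.flipRate w σ) * h σ := by
  have hl : ∀ k, J.lamLaw (B w) k = ENNReal.ofReal (J.lam w (B w).seq k) := fun _ => rfl
  have h1 := J.hasSum_lam_mul_flipProb (B w) σ
  have h2 := (J.hasSum_lam (B w)).sub h1
  simp only [← mul_one_sub] at h2
  simp only [sum_spinLaw, mul_add, ← mul_assoc, hl, ← ENNReal.ofReal_mul (J.lam_nonneg (B w) _)]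
  rw [ENNReal.tsum_add, ENNReal.tsum_mul_right, ENNReal.tsum_mul_right,
    ← ENNReal.ofReal_tsum_of_nonneg (fun k => mul_nonneg (J.lam_nonneg (B w) k)
      (J.flipProb_mem w _ k σ).1) h1.summable,
    ← ENNReal.ofReal_tsum_of_nonneg (fun k => mul_nonneg (J.lam_nonneg (B w) k)
      (sub_nonneg.mpr (J.flipProb_mem w _ k σ).2)) h2.summable, h1.tsum_eq, h2.tsum_eq]

/-- A Gibbs measure is invariant under the one-site spin-flip kernel. -/
lemma IsGibbs.lintegral_tsum_lamLaw {J : Interaction d} {π : Measure (Config d)}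
    (hπ : J.IsGibbs π) (B : ∀ v, J.Growth v) (w : Vertex d) {h : Config d → ℝ≥0∞}
    (hh : Measurable h) :
    ∫⁻ σ, ∑' k, J.lamLaw (B w) k * ∑ a, spinLaw B w k σ a * h (Function.update σ w a) ∂π =
      ∫⁻ σ, h σ ∂π := by
  have hm := (J.measurable_flipRate w).ennreal_ofReal
  have hm' : Measurable fun σ => ENNReal.ofReal (J.flipRate w σ) * h (flip w σ) :=
    hm.mul (hh.comp (measurable_flip w))
  have hm'' : Measurable fun σ => ENNReal.ofReal (J.flipRate w σ) * h σ := hm.mul hh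
  simp only [tsum_lamLaw_mul_sum_spinLaw]
  rw [lintegral_add_left hm', hπ.lintegral_flipRate_flip w hh, ← lintegral_add_left hm'']
  refine lintegral_congr fun σ => ?_
  rw [← add_mul, ← ENNReal.ofReal_add (J.flipRate_nonneg w σ)
    (sub_nonneg.mpr (J.flipRate_le_one w σ))]
  simp

end Interaction

/-! ### The chain of records -/

lemma PMF.tsum_bind_mul {α β : Type*} (p : PMF α) (q : α → PMF β) (f : β → ℝ≥0∞) :
    ∑' b, p.bind q b * f b = ∑' a, p a * ∑' b, q a b * f b := by
  simp only [PMF.bind_apply, ← ENNReal.tsum_mul_right, ← ENNReal.tsum_mul_left, mul_assoc]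
  exact ENNReal.tsum_comm

lemma PMF.tsum_pure_mul {β : Type*} (b₀ : β) (f : β → ℝ≥0∞) :
    ∑' b, PMF.pure b₀ b * f b = f b₀ := by
  rw [tsum_eq_single b₀ fun b hb => by simp [hb]]
  simp

lemma PMF.tsum_map_mul {α β : Type*} (p : PMF α) (g : α → β) (f : β → ℝ≥0∞) :
    ∑' b, p.map g b * f b = ∑' a, p a * f (g a) := by
  rw [PMF.map, PMF.tsum_bind_mul]
  simp only [Function.comp_apply, PMF.tsum_pure_mul]

lemma PMF.lintegral_toMeasure {α : Type*} [MeasurableSpace α] [Countable α]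
    [MeasurableSingletonClass α] (p : PMF α) (f : α → ℝ≥0∞) :
    ∫⁻ a, f a ∂p.toMeasure = ∑' a, p a * f a := by
  rw [lintegral_countable']
  exact tsum_congr fun a => by
    rw [p.toMeasure_apply_singleton a (measurableSet_singleton a), mul_comm]

/-- The empty record. -/
def Sketch.nil (d : ℕ) : Sketch d := ([] : List (Vertex d × ℕ))

/-- The record `l` followed by the draw `wk`. -/
def Sketch.snoc {d : ℕ} (l : Sketch d) (wk : Vertex d × ℕ) : Sketch d := List.append l [wk]

/-- Induction on a record, from its last draw. -/
lemma Sketch.induction_snoc {d : ℕ} {motive : Sketch d → Prop} (nil : motive (Sketch.nil d))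
    (snoc : ∀ (l : Sketch d) (w : Vertex d) (k : ℕ), motive l → motive (l.snoc (w, k)))
    (l : Sketch d) : motive l :=
  List.reverseRecOn (motive := motive) l nil fun l wk h => snoc l wk.1 wk.2 h

namespace Interaction

variable {d : ℕ}

section Chain

variable {J : Interaction d} (B : ∀ v, J.Growth v) (C₀ : Finset (Vertex d))

lemma clan_snoc (l : Sketch d) (wk : Vertex d × ℕ) :
    clan B C₀ (l.snoc wk) = advance B (clan B C₀ l) wk :=
  List.foldl_append (f := advance B) (b := C₀) (l := l) (l' := [wk])

lemma measurable_record (n : ℕ) : Measurable fun ω : ℕ → Sketch d => ω n := measurable_pi_apply n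

lemma measurable_record_pair (n m : ℕ) (F : Sketch d × Sketch d → ℝ≥0∞) :
    Measurable fun ω : ℕ → Sketch d => F (ω n, ω m) :=
  (Measurable.of_discrete (f := F)).comp ((measurable_record n).prodMk (measurable_record m))

lemma lintegral_sketchKernel_of_nonempty (l : Sketch d) (h : (clan B C₀ l).Nonempty)
    (f : Sketch d → ℝ≥0∞) :
    ∫⁻ l', f l' ∂(sketchKernel B C₀ l) = ∑' w, J.vertexLaw (clan B C₀ l) h w *
      ∑' k, J.lamLaw (B w) k * f (l.snoc (w, k)) := by
  change ∫⁻ l', f l' ∂(sketchStep B C₀ l).toMeasure = _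
  rw [PMF.lintegral_toMeasure, sketchStep, dif_pos h, PMF.tsum_bind_mul]
  exact tsum_congr fun w => congrArg _
    (PMF.tsum_map_mul (J.lamLaw (B w)) (fun k => l.snoc (w, k)) f)

lemma lintegral_sketchKernel_of_empty (l : Sketch d) (h : clan B C₀ l = ∅)
    (f : Sketch d → ℝ≥0∞) : ∫⁻ l', f l' ∂(sketchKernel B C₀ l) = f l := by
  change ∫⁻ l', f l' ∂(sketchStep B C₀ l).toMeasure = _
  rw [PMF.lintegral_toMeasure, sketchStep, dif_neg (by simp [h]), PMF.tsum_pure_mul]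

instance : IsProbabilityMeasure (sketchMeasure B C₀) := by
  have : IsProbabilityMeasure (Measure.dirac (Sketch.nil d)) := Measure.dirac.isProbabilityMeasure
  exact inferInstanceAs (IsProbabilityMeasure (Kernel.trajMeasure (X := fun _ => Sketch d)
    (Measure.dirac (Sketch.nil d)) _))

/-- The one-step Markov property of the chain of records. -/
lemma lintegral_sketchMeasure_succ (n : ℕ) (F : Sketch d → Sketch d → ℝ≥0∞) :
    ∫⁻ ω, F (ω n) (ω (n + 1)) ∂(sketchMeasure B C₀) =
      ∫⁻ ω, ∫⁻ l', F (ω n) l' ∂(sketchKernel B C₀ (ω n)) ∂(sketchMeasure B C₀) := by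
  have : IsProbabilityMeasure (Measure.dirac (Sketch.nil d)) := Measure.dirac.isProbabilityMeasure
  have h := Kernel.map_frestrictLe_trajMeasure_compProd_eq_map_trajMeasure
    (X := fun _ => Sketch d) (μ₀ := Measure.dirac (Sketch.nil d))
    (κ := fun n => (sketchKernel B C₀).comap
      (fun h : (i : Finset.Iic n) → Sketch d => h ⟨n, Finset.mem_Iic.mpr le_rfl⟩)
      (measurable_pi_apply _)) (a := n)
  change (sketchMeasure B C₀).map _ ⊗ₘ _ = (sketchMeasure B C₀).map _ at h
  let G : ((i : Finset.Iic n) → Sketch d) × Sketch d → ℝ≥0∞ :=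
    fun x => F (x.1 ⟨n, Finset.mem_Iic.mpr le_rfl⟩) x.2
  have hG : Measurable G := by
    have h1 : Measurable fun p : Sketch d × Sketch d => F p.1 p.2 := Measurable.of_discrete
    have h2 : Measurable fun h : (i : Finset.Iic n) → Sketch d =>
        h ⟨n, Finset.mem_Iic.mpr le_rfl⟩ := measurable_pi_apply _
    exact h1.comp ((h2.comp measurable_fst).prodMk measurable_snd)
  have h2 := congrArg (fun μ => ∫⁻ x, G x ∂μ) h
  beta_reduce at h2
  have hK : Measurable fun l => ∫⁻ l', F l l' ∂(sketchKernel B C₀ l) := Measurable.of_discrete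
  rw [lintegral_map hG (by fun_prop), Measure.lintegral_compProd hG, lintegral_map] at h2
  · exact h2.symm
  · exact hK.comp (measurable_pi_apply _)
  · fun_prop

lemma lintegral_sketchMeasure_zero (f : Sketch d → ℝ≥0∞) :
    ∫⁻ ω, f (ω 0) ∂(sketchMeasure B C₀) = f (Sketch.nil d) := by
  have h : (sketchMeasure B C₀).map (Preorder.frestrictLe 0) =
      (Measure.dirac (Sketch.nil d) : Measure (Sketch d)).map
        (MeasurableEquiv.piUnique (fun _ : Finset.Iic 0 => Sketch d)).symm := by
    rw [sketchMeasure, Kernel.trajMeasure, Measure.map_comp _ _ (by fun_prop),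
      Kernel.traj_map_frestrictLe, Kernel.partialTraj_self, Measure.id_comp]
    rfl
  have hf : Measurable f := Measurable.of_discrete
  let G : ((i : Finset.Iic 0) → Sketch d) → ℝ≥0∞ := fun x => f (x ⟨0, by simp⟩)
  have hG : Measurable G := hf.comp (measurable_pi_apply _)
  have h2 := congrArg (fun μ => ∫⁻ x, G x ∂μ) h
  beta_reduce at h2
  rw [lintegral_map hG (by fun_prop), lintegral_map hG (by fun_prop), lintegral_dirac] at h2
  exact h2

/-- Once the set is empty, the record does not change any more. -/
lemma ae_sketchProcess_absorbing :
    ∀ᵐ ω ∂(sketchMeasure B C₀), ∀ n, sketchProcess B C₀ n ω = ∅ → ω (n + 1) = ω n := by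
  classical
  rw [ae_all_iff]
  intro n
  have h := lintegral_sketchMeasure_succ B C₀ n
    (fun l l' => if clan B C₀ l = ∅ ∧ l' ≠ l then 1 else 0)
  have h0 : ∀ l : Sketch d, ∫⁻ l', (if clan B C₀ l = ∅ ∧ l' ≠ l then 1 else 0 : ℝ≥0∞)
      ∂(sketchKernel B C₀ l) = 0 := by
    intro l
    by_cases hl : clan B C₀ l = ∅
    · rw [lintegral_sketchKernel_of_empty B C₀ l hl]; simp
    · simp [hl]
  simp only [h0, lintegral_zero] at h
  have hm : Measurable fun ω : ℕ → Sketch d =>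
      (if clan B C₀ (ω n) = ∅ ∧ ω (n + 1) ≠ ω n then 1 else 0 : ℝ≥0∞) :=
    measurable_record_pair n (n + 1) fun p => if clan B C₀ p.1 = ∅ ∧ p.2 ≠ p.1 then 1 else 0
  rw [lintegral_eq_zero_iff hm] at h
  filter_upwards [h] with ω hω hC
  by_contra hne
  simp only [sketchProcess] at hC
  simp [hC, hne] at hω

/-- A function on records whose conditional expectation never changes has constant expectation
along the chain. -/
lemma lintegral_sketchMeasure_of_harmonic {Φ : Sketch d → ℝ≥0∞}
    (h : ∀ l, ∫⁻ l', Φ l' ∂(sketchKernel B C₀ l) = Φ l) (n : ℕ) :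
    ∫⁻ ω, Φ (ω n) ∂(sketchMeasure B C₀) = Φ (Sketch.nil d) := by
  induction n with
  | zero => exact lintegral_sketchMeasure_zero B C₀ Φ
  | succ n ih => rw [lintegral_sketchMeasure_succ B C₀ n (fun _ l' => Φ l')]; simpa only [h] using ih

/-- A Lyapunov function: if each step taken from a nonempty set decreases the expectation of `V`
by at least `ε`, then the expected number of steps is finite, so that the process dies out. -/
lemma ae_eventually_sketchProcess_eq_empty {V : Sketch d → ℝ≥0∞} {ε : ℝ≥0∞} (hε : ε ≠ 0)
    (hV : V (Sketch.nil d) ≠ ⊤)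
    (h : ∀ l, (clan B C₀ l).Nonempty → ∫⁻ l', V l' ∂(sketchKernel B C₀ l) + ε ≤ V l) :
    (∑' n, sketchMeasure B C₀ {ω | sketchProcess B C₀ n ω ≠ ∅} ≠ ⊤) ∧
      ∀ᵐ ω ∂(sketchMeasure B C₀), ∀ᶠ n in atTop, sketchProcess B C₀ n ω = ∅ := by
  classical
  have hms : ∀ n, MeasurableSet {ω | sketchProcess B C₀ n ω ≠ ∅} := fun n =>
    (measurable_pi_apply n : Measurable fun ω : ℕ → Sketch d => ω n)
      (MeasurableSet.of_discrete (s := {l | clan B C₀ l ≠ ∅}))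
  have hmV : ∀ n, Measurable fun ω : ℕ → Sketch d => V (ω n) := fun n =>
    (Measurable.of_discrete (f := V)).comp (measurable_pi_apply n)
  have step : ∀ n, ∫⁻ ω, V (ω (n + 1)) ∂(sketchMeasure B C₀) +
      ε * sketchMeasure B C₀ {ω | sketchProcess B C₀ n ω ≠ ∅} ≤
        ∫⁻ ω, V (ω n) ∂(sketchMeasure B C₀) := by
    intro n
    rw [lintegral_sketchMeasure_succ B C₀ n (fun _ l' => V l'), ← lintegral_indicator_const (hms n),
      ← lintegral_add_right _ (measurable_const.indicator (hms n))]
    refine lintegral_mono fun ω => ?_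
    by_cases hC : clan B C₀ (ω n) = ∅
    · have : ω ∉ {ω | sketchProcess B C₀ n ω ≠ ∅} := fun h => h hC
      rw [Set.indicator_of_notMem this, add_zero, lintegral_sketchKernel_of_empty B C₀ _ hC]
    · have : ω ∈ {ω | sketchProcess B C₀ n ω ≠ ∅} := hC
      rw [Set.indicator_of_mem this]
      exact h _ (Finset.nonempty_iff_ne_empty.mpr hC)
  have total : ∀ N, ∫⁻ ω, V (ω N) ∂(sketchMeasure B C₀) + ∑ n ∈ Finset.range N,
      ε * sketchMeasure B C₀ {ω | sketchProcess B C₀ n ω ≠ ∅} ≤ V (Sketch.nil d) := by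
    intro N
    induction N with
    | zero => simp [lintegral_sketchMeasure_zero]
    | succ N ih =>
      rw [Finset.sum_range_succ, add_comm (Finset.sum _ _), ← add_assoc]
      exact (add_le_add_left (step N) _).trans ih
  have hsum : ε * ∑' n, sketchMeasure B C₀ {ω | sketchProcess B C₀ n ω ≠ ∅} ≠ ⊤ := by
    rw [← ENNReal.tsum_mul_left]
    refine ne_top_of_le_ne_top hV (ENNReal.tsum_le_of_sum_range_le fun N => ?_)
    exact le_add_self.trans (total N)
  have hsum' : ∑' n, sketchMeasure B C₀ {ω | sketchProcess B C₀ n ω ≠ ∅} ≠ ⊤ := fun htop =>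
    hsum (by rw [htop, ENNReal.mul_top hε])
  refine ⟨hsum', ?_⟩
  filter_upwards [ae_eventually_notMem hsum'] with ω hω
  filter_upwards [hω] with n hn
  simpa using hn

/-- Distinct final records are incompatible, so the stopping probabilities add up to at most one. -/
lemma tsum_stopProb_le_one : ∑' l, stopProb B C₀ l ≤ 1 := by
  have hmeas : ∀ l : Sketch d, MeasurableSet {ω : ℕ → Sketch d | ∃ n, ω n = l ∧
      sketchProcess B C₀ n ω = ∅} := by
    intro l
    have : {ω : ℕ → Sketch d | ∃ n, ω n = l ∧ sketchProcess B C₀ n ω = ∅} =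
        ⋃ n, (fun ω : ℕ → Sketch d => ω n) ⁻¹' {l' | l' = l ∧ clan B C₀ l' = ∅} := by
      ext ω; simp [sketchProcess]
    rw [this]
    exact MeasurableSet.iUnion fun n => measurable_pi_apply n MeasurableSet.of_discrete
  unfold stopProb
  rw [← measure_iUnion₀ ?_ fun l => (hmeas l).nullMeasurableSet]
  · exact prob_le_one
  · intro l l' hne
    refine measure_mono_null (t := {ω | ¬ ∀ n, sketchProcess B C₀ n ω = ∅ → ω (n + 1) = ω n}) ?_
      (ae_iff.mp (ae_sketchProcess_absorbing B C₀))
    rintro ω ⟨⟨n, hn, hCn⟩, ⟨m, hm, hCm⟩⟩ hω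
    have stay : ∀ n, sketchProcess B C₀ n ω = ∅ → ∀ j, ω (n + j) = ω n := by
      intro n hC j
      induction j with
      | zero => rfl
      | succ j ih =>
        have : sketchProcess B C₀ (n + j) ω = ∅ := by rw [sketchProcess, ih]; exact hC
        rw [← ih, ← hω _ this, add_assoc]
    exact hne (by rw [← hn, ← hm, ← stay n hCn m, ← stay m hCm n, add_comm])

end Chain

/-! ### The forward procedure and its duality with the sketch -/

section Forward

variable {J : Interaction d} (B : ∀ v, J.Growth v) (C₀ : Finset (Vertex d))

lemma forward_snoc (σ : Config d) (l : Sketch d) (w : Vertex d) (k : ℕ) :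
    forward B σ (l.snoc (w, k)) =
      (spinLaw B w k σ).bind fun a => forward B (Function.update σ w a) l := by
  change forward B σ (List.append l [(w, k)]) = _
  induction l with
  | nil =>
    change (PMF.pure σ).bind _ = _
    rw [PMF.pure_bind]
    rfl
  | cons wk l ih =>
    change (forward B σ (List.append l [(w, k)])).bind _ = _
    rw [ih, PMF.bind_bind]
    rfl

lemma chi_congr {A : Finset (Vertex d)} {σ σ' : Config d} (h : ∀ u ∈ A, σ u = σ' u) :
    chi A σ = chi A σ' :=
  Finset.prod_congr rfl fun u hu => by rw [h u hu]

lemma spinSum_congr (J : Interaction d) {𝒜 : Set (Finset (Vertex d))} {D : Finset (Vertex d)}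
    (h𝒜 : ∀ A ∈ 𝒜, A ⊆ D) {σ σ' : Config d} (h : ∀ u ∈ D, σ u = σ' u) :
    J.spinSum 𝒜 σ = J.spinSum 𝒜 σ' :=
  tsum_congr fun A => by rw [chi_congr fun u hu => h u (h𝒜 A.1 A.2 hu)]

lemma flipProb_congr {v : Vertex d} (D : J.Growth v) (k : ℕ) {σ σ' : Config d}
    (h : ∀ u ∈ D.seq k, σ u = σ' u) : J.flipProb v D.seq k σ = J.flipProb v D.seq k σ' := by
  match k with
  | 0 => rfl
  | 1 =>
    simp only [flipProb]
    rw [J.spinSum_congr (fun A hA => hA.2) h]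
  | k + 2 =>
    have hk : D.seq (k + 1) ⊆ D.seq (k + 2) := (D.seq_succ _).1
    simp only [flipProb]
    rw [J.spinSum_congr (𝒜 := within v (D.seq (k + 1))) (fun A hA => hA.2.trans hk) h,
      J.spinSum_congr (𝒜 := shell v _ _) (fun A hA => hA.2.1) h]

lemma spinLaw_congr (w : Vertex d) {k : ℕ} {σ σ' : Config d}
    (h : k ≠ 0 → ∀ u ∈ (B w).seq k, σ u = σ' u) : spinLaw B w k σ = spinLaw B w k σ' := by
  refine PMF.ext fun a => ?_
  simp only [spinLaw, PMF.ofFintype_apply, updateProb]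
  congr 1
  by_cases hk : k = 0
  · subst hk
    simp only [flipProb]
    split_ifs <;> norm_num
  · have hw : w ∈ (B w).seq k := seq_mono (B w) (Nat.zero_le k) (by simp [(B w).seq_zero])
    rw [flipProb_congr (B w) k (h hk), h hk w hw]

/-- The output on the window `C₀` depends on the reference configuration only through its spins
on the set that the sketch has reached. -/
lemma forward_map_restrict_congr (l : Sketch d) {σ σ' : Config d}
    (h : ∀ u ∈ clan B C₀ l, σ u = σ' u) :
    (forward B σ l).map C₀.restrict = (forward B σ' l).map C₀.restrict := by
  induction l using Sketch.induction_snoc generalizing σ σ' with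
  | nil =>
    change (PMF.pure σ).map _ = (PMF.pure σ').map _
    rw [PMF.pure_map, PMF.pure_map]
    congr 1
    funext u
    exact h u.1 u.2
  | snoc l w k ih =>
    rw [clan_snoc] at h
    unfold advance at h
    simp only at h
    rw [forward_snoc, forward_snoc, PMF.map_bind, PMF.map_bind]
    have hupd : ∀ u ∈ clan B C₀ l, u ≠ w → σ u = σ' u := by
      intro u hu huw
      apply h
      split_ifs
      · exact Finset.mem_erase.mpr ⟨huw, hu⟩
      · exact Finset.mem_union_left _ hu
    rw [spinLaw_congr B w (k := k) (σ' := σ')]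
    · congr 1
      funext a
      refine ih fun u hu => ?_
      by_cases huw : u = w
      · subst huw; simp
      · simp [huw, hupd u hu huw]
    · intro hk u hu
      apply h
      rw [if_neg hk]
      exact Finset.mem_union_right _ hu

/-- A function of finitely many spins is measurable, whatever its values. -/
lemma measurable_of_finite_dependence {α : Type*} [MeasurableSpace α] (s : Finset (Vertex d))
    {f : Config d → α} (hf : ∀ σ σ' : Config d, (∀ u ∈ s, σ u = σ' u) → f σ = f σ') :
    Measurable f := by
  classical
  let g : (s → ℤˣ) → α := fun τ => f fun u => if h : u ∈ s then τ ⟨u, h⟩ else 1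
  have hfg : f = g ∘ s.restrict := by
    funext σ
    exact hf _ _ fun u hu => by simp [hu]
  rw [hfg]
  exact (Measurable.of_discrete (f := g)).comp (Finset.measurable_restrict s)

/-- The probability that the forward procedure, applied to the record `l` and started from `σ`,
produces spins on `C₀` in the set `S`. -/
noncomputable def outputProb (S : Set (C₀ → ℤˣ)) (l : Sketch d) (σ : Config d) : ℝ≥0∞ :=
  (forward B σ l).toMeasure (C₀.restrict ⁻¹' S)

variable {B C₀}

lemma measurableSet_window (S : Set (C₀ → ℤˣ)) :
    MeasurableSet ((C₀.restrict : Config d → C₀ → ℤˣ) ⁻¹' S) :=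
  Finset.measurable_restrict C₀ MeasurableSet.of_discrete

lemma outputProb_le_one (S : Set (C₀ → ℤˣ)) (l : Sketch d) (σ : Config d) :
    outputProb B C₀ S l σ ≤ 1 := prob_le_one

lemma outputProb_congr (S : Set (C₀ → ℤˣ)) (l : Sketch d) {σ σ' : Config d}
    (h : ∀ u ∈ clan B C₀ l, σ u = σ' u) : outputProb B C₀ S l σ = outputProb B C₀ S l σ' := by
  have hm : Measurable (C₀.restrict : Config d → C₀ → ℤˣ) := Finset.measurable_restrict C₀
  unfold outputProb
  rw [← PMF.toMeasure_map_apply _ _ _ hm MeasurableSet.of_discrete,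
    ← PMF.toMeasure_map_apply _ _ _ hm MeasurableSet.of_discrete,
    forward_map_restrict_congr B C₀ l h]

lemma measurable_outputProb (S : Set (C₀ → ℤˣ)) (l : Sketch d) :
    Measurable (outputProb B C₀ S l) :=
  measurable_of_finite_dependence (clan B C₀ l) fun _ _ h => outputProb_congr S l h

lemma outputProb_snoc (S : Set (C₀ → ℤˣ)) (l : Sketch d) (w : Vertex d) (k : ℕ) (σ : Config d) :
    outputProb B C₀ S (l.snoc (w, k)) σ =
      ∑ a, spinLaw B w k σ a * outputProb B C₀ S l (Function.update σ w a) := by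
  unfold outputProb
  rw [forward_snoc, PMF.toMeasure_bind_apply _ _ _ (measurableSet_window S), tsum_fintype]

lemma outputProb_nil (S : Set (C₀ → ℤˣ)) (σ : Config d) :
    outputProb B C₀ S (Sketch.nil d) σ = (C₀.restrict ⁻¹' S).indicator 1 σ := by
  unfold outputProb
  change (PMF.pure σ).toMeasure _ = _
  rw [PMF.toMeasure_pure, Measure.dirac_apply' _ (measurableSet_window S)]

/-- Duality: under a Gibbs measure, one more backward step of the sketch does not change the mean
output of the forward procedure. -/
lemma IsGibbs.lintegral_outputProb_harmonic {π : Measure (Config d)} (hπ : J.IsGibbs π)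
    (S : Set (C₀ → ℤˣ)) (l : Sketch d) :
    ∫⁻ l', (∫⁻ σ, outputProb B C₀ S l' σ ∂π) ∂(sketchKernel B C₀ l) =
      ∫⁻ σ, outputProb B C₀ S l σ ∂π := by
  by_cases h : (clan B C₀ l).Nonempty
  · rw [lintegral_sketchKernel_of_nonempty B C₀ l h]
    have hw : ∀ w, ∑' k, J.lamLaw (B w) k * ∫⁻ σ, outputProb B C₀ S (l.snoc (w, k)) σ ∂π =
        ∫⁻ σ, outputProb B C₀ S l σ ∂π := by
      intro w
      rw [← hπ.lintegral_tsum_lamLaw B w (measurable_outputProb S l), lintegral_tsum]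
      · refine tsum_congr fun k => ?_
        rw [← lintegral_const_mul _ (measurable_outputProb S _)]
        simp only [outputProb_snoc]
      · intro k
        simp only [← outputProb_snoc]
        exact ((measurable_outputProb S _).const_mul _).aemeasurable
    simp only [hw]
    rw [ENNReal.tsum_mul_right, PMF.tsum_coe, one_mul]
  · exact lintegral_sketchKernel_of_empty B C₀ l (Finset.not_nonempty_iff_eq_empty.mp h) _

lemma IsGibbs.measure_window_le {π : Measure (Config d)} (hπ : J.IsGibbs π)
    (S : Set (C₀ → ℤˣ)) (σ₀ : Config d) (n : ℕ) :
    π (C₀.restrict ⁻¹' S) ≤ outputLaw B C₀ σ₀ (C₀.restrict ⁻¹' S) +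
      sketchMeasure B C₀ {ω | sketchProcess B C₀ n ω ≠ ∅} := by
  classical
  have := hπ.1
  have h1 : π (C₀.restrict ⁻¹' S) =
      ∫⁻ ω, (∫⁻ σ, outputProb B C₀ S (ω n) σ ∂π) ∂(sketchMeasure B C₀) := by
    rw [lintegral_sketchMeasure_of_harmonic B C₀
      (Φ := fun l => ∫⁻ σ, outputProb B C₀ S l σ ∂π) (hπ.lintegral_outputProb_harmonic S)]
    simp only [outputProb_nil]
    rw [lintegral_indicator_one (measurableSet_window S)]
  have hmN : MeasurableSet {ω | sketchProcess B C₀ n ω ≠ ∅} :=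
    measurable_record n (MeasurableSet.of_discrete (s := {l | clan B C₀ l ≠ ∅}))
  have hmE : ∀ l : Sketch d, MeasurableSet {ω | ω n = l ∧ sketchProcess B C₀ n ω = ∅} := fun l =>
    measurable_record n (MeasurableSet.of_discrete (s := {l' | l' = l ∧ clan B C₀ l' = ∅}))
  have h2 : ∀ ω, ∫⁻ σ, outputProb B C₀ S (ω n) σ ∂π ≤
      (∑' l, {ω | ω n = l ∧ sketchProcess B C₀ n ω = ∅}.indicator
        (fun _ => outputProb B C₀ S l σ₀) ω) +
        {ω | sketchProcess B C₀ n ω ≠ ∅}.indicator (fun _ => 1) ω := by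
    intro ω
    by_cases hC : clan B C₀ (ω n) = ∅
    · refine le_trans ?_ le_self_add
      refine le_trans ?_ (ENNReal.le_tsum (ω n))
      rw [Set.indicator_of_mem (show ω ∈ {ω' | ω' n = ω n ∧ sketchProcess B C₀ n ω' = ∅} from
        ⟨rfl, hC⟩)]
      rw [lintegral_congr fun σ => outputProb_congr (σ' := σ₀) S (ω n) (by simp [hC])]
      simp
    · refine le_trans ?_ le_add_self
      rw [Set.indicator_of_mem (show ω ∈ {ω | sketchProcess B C₀ n ω ≠ ∅} from hC)]
      exact (lintegral_mono fun σ => outputProb_le_one S _ σ).trans (by simp)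
  rw [h1]
  refine (lintegral_mono h2).trans ?_
  rw [lintegral_add_right _ (measurable_const.indicator hmN), lintegral_indicator_const hmN, one_mul,
    lintegral_tsum fun l => (measurable_const.indicator (hmE l)).aemeasurable]
  gcongr
  rw [outputLaw, Measure.sum_apply _ (measurableSet_window S)]
  refine ENNReal.tsum_le_tsum fun l => ?_
  rw [lintegral_indicator_const (hmE l), mul_comm, Measure.smul_apply, smul_eq_mul]
  exact mul_le_mul' (measure_mono fun ω hω => ⟨n, hω⟩) le_rfl

/-- If the sketch dies out, the algorithm simulates every Gibbs measure on the window. -/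
lemma IsGibbs.outputLaw_map_restrict {π : Measure (Config d)} (hπ : J.IsGibbs π) (σ₀ : Config d)
    (hdie : ∑' n, sketchMeasure B C₀ {ω | sketchProcess B C₀ n ω ≠ ∅} ≠ ⊤) :
    (outputLaw B C₀ σ₀).map C₀.restrict = π.map C₀.restrict := by
  have := hπ.1
  have hm : Measurable (C₀.restrict : Config d → C₀ → ℤˣ) := Finset.measurable_restrict C₀
  have : IsProbabilityMeasure (π.map (C₀.restrict : Config d → C₀ → ℤˣ)) :=
    Measure.isProbabilityMeasure_map hm.aemeasurable
  have hle : π.map C₀.restrict ≤ (outputLaw B C₀ σ₀).map C₀.restrict := by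
    refine Measure.le_iff.mpr fun S hS => ?_
    rw [Measure.map_apply hm hS, Measure.map_apply hm hS]
    have h1 := (ENNReal.tendsto_atTop_zero_of_tsum_ne_top hdie).const_add
      (outputLaw B C₀ σ₀ (C₀.restrict ⁻¹' S))
    rw [add_zero] at h1
    exact ge_of_tendsto' h1 fun n => hπ.measure_window_le S σ₀ n
  have huniv : (outputLaw B C₀ σ₀).map C₀.restrict Set.univ ≤ 1 := by
    rw [Measure.map_apply hm MeasurableSet.univ, Set.preimage_univ, outputLaw,
      Measure.sum_apply _ MeasurableSet.univ]
    simpa using tsum_stopProb_le_one B C₀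
  have hfin : IsFiniteMeasure ((outputLaw B C₀ σ₀).map C₀.restrict) :=
    ⟨huniv.trans_lt ENNReal.one_lt_top⟩
  refine (Measure.eq_of_le_of_measure_univ_eq hle ?_).symm
  rw [measure_univ]
  exact le_antisymm (by simpa using hle Set.univ) huniv

end Forward

/-! ### Extinction of the sketch -/

lemma exists_absSum_star_le (J : Interaction d) : ∃ s : ℝ, ∀ v, J.absSum (star v) ≤ s := by
  refine ⟨(⨆ v : Vertex d, ∑' B : {B : Finset (Vertex d) // v ∈ B},
    ENNReal.ofReal (B.1.card * |J.coupling B.1|)).toReal, fun v => ?_⟩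
  have h1 : ENNReal.ofReal (J.absSum (star v)) ≤ ∑' B : {B : Finset (Vertex d) // v ∈ B},
      ENNReal.ofReal (B.1.card * |J.coupling B.1|) := by
    rw [absSum, ENNReal.ofReal_tsum_of_nonneg (fun _ => abs_nonneg _) (J.summable_star v)]
    refine ENNReal.tsum_le_tsum fun B => ENNReal.ofReal_le_ofReal ?_
    have h3 : (1 : ℝ) ≤ (B.1.card : ℝ) := by exact_mod_cast Finset.card_pos.mpr ⟨v, B.2⟩
    exact le_mul_of_one_le_left (abs_nonneg _) h3
  rw [← ENNReal.ofReal_le_iff_le_toReal J.bounded.ne]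
  exact h1.trans (le_iSup (fun v : Vertex d => ∑' B : {B : Finset (Vertex d) // v ∈ B},
    ENNReal.ofReal (B.1.card * |J.coupling B.1|)) v)

lemma hasSum_birthSum (J : Interaction d) {v : Vertex d} (D : J.Growth v)
    (h : J.birthSum v D.seq < ⊤) :
    HasSum (fun k => (D.seq (k + 1)).card * J.lam v D.seq (k + 1))
      (J.birthSum v D.seq).toReal := by
  have h0 : ∀ k, 0 ≤ (D.seq (k + 1)).card * J.lam v D.seq (k + 1) := fun k =>
    mul_nonneg (Nat.cast_nonneg _) (J.lam_nonneg D _)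
  have h1 := ENNReal.hasSum_toReal h.ne
  rw [birthSum, ENNReal.tsum_toReal_eq fun _ => ENNReal.ofReal_ne_top]
  simpa only [ENNReal.toReal_ofReal (h0 _)] using h1

/-- A concave function of the size of the current set, with slope `K ^ (R - m)` between `m - 1` and
`m`: steep up to the size `R`, and of slope `1` beyond. -/
def potential (K : ℝ) (R m : ℕ) : ℝ := ∑ i ∈ Finset.range m, K ^ (R - (i + 1))

lemma potential_succ (K : ℝ) (R m : ℕ) :
    potential K R (m + 1) = potential K R m + K ^ (R - (m + 1)) :=
  Finset.sum_range_succ _ _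

lemma potential_nonneg {K : ℝ} (hK : 1 ≤ K) (R m : ℕ) : 0 ≤ potential K R m :=
  Finset.sum_nonneg fun _ _ => pow_nonneg (by linarith) _

lemma potential_mono {K : ℝ} (hK : 1 ≤ K) (R : ℕ) : Monotone (potential K R) :=
  monotone_nat_of_le_succ fun m => by
    rw [potential_succ]
    have : 0 ≤ K ^ (R - (m + 1)) := pow_nonneg (by linarith) _
    linarith

lemma potential_add_le {K : ℝ} (hK : 1 ≤ K) (R m j : ℕ) :
    potential K R (m + j) ≤ potential K R m + K ^ (R - (m + 1)) * j := by
  induction j with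
  | zero => simp
  | succ j ih =>
    rw [← add_assoc, potential_succ]
    have : K ^ (R - (m + j + 1)) ≤ K ^ (R - (m + 1)) := pow_le_pow_right₀ hK (by omega)
    push_cast
    linarith

/-- The mean increment of the potential when the vertex `w` has been selected in a set of size
`m + 1`. -/
lemma tsum_lamLaw_mul_potential_le {J : Interaction d} (B : ∀ v, J.Growth v) {K : ℝ} (hK : 1 ≤ K)
    (R : ℕ) {m : ℕ} {C : Finset (Vertex d)} (hC : C.card = m + 1) {w : Vertex d} (hw : w ∈ C)
    (hfin : J.birthSum w (B w).seq < ⊤) :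
    0 ≤ potential K R (m + 1) + (K ^ (R - (m + 2)) * ((J.birthSum w (B w).seq).toReal - 1 +
        J.lam w (B w).seq 0) - K ^ (R - (m + 1)) * J.lam w (B w).seq 0) ∧
    ∑' k, J.lamLaw (B w) k * ENNReal.ofReal (potential K R (advance B C (w, k)).card) ≤
      ENNReal.ofReal (potential K R (m + 1) + (K ^ (R - (m + 2)) *
        ((J.birthSum w (B w).seq).toReal - 1 + J.lam w (B w).seq 0) -
          K ^ (R - (m + 1)) * J.lam w (B w).seq 0)) := by
  set D := (B w).seq with hD
  set β := (J.birthSum w D).toReal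
  set φ := potential K R
  set a := K ^ (R - (m + 2)) with ha
  have ha0 : 0 ≤ a := pow_nonneg (by linarith) _
  have hl := J.lam_nonneg (B w)
  have hwD : ∀ k, w ∈ D k := fun k =>
    seq_mono (B w) (Nat.zero_le k) (by simp [(B w).seq_zero])
  have hcard : ∀ k, (1 : ℝ) ≤ (D k).card := fun k => by
    exact_mod_cast Finset.card_pos.mpr ⟨w, hwD k⟩
  let g : ℕ → ℝ := fun k => Nat.casesOn k (J.lam w D 0 * φ m)
    fun k => J.lam w D (k + 1) * (φ (m + 1) + a * ((D (k + 1)).card - 1))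
  have hg0 : ∀ k, 0 ≤ g k := by
    intro k
    cases k with
    | zero => exact mul_nonneg (hl 0) (potential_nonneg hK _ _)
    | succ k =>
      have := hcard (k + 1)
      exact mul_nonneg (hl _) (add_nonneg (potential_nonneg hK _ _)
        (mul_nonneg ha0 (by linarith)))
  have hgsum : HasSum g (φ (m + 1) + (a * (β - 1 + J.lam w D 0) -
      K ^ (R - (m + 1)) * J.lam w D 0)) := by
    have h1 : HasSum (fun k => J.lam w D (k + 1)) (1 - J.lam w D 0) := by
      have := (hasSum_nat_add_iff' 1).mpr (J.hasSum_lam (B w))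
      simpa using this
    have h2 := J.hasSum_birthSum (B w) hfin
    have h3 : HasSum (fun k => g (k + 1)) (φ (m + 1) * (1 - J.lam w D 0) +
        a * (β - (1 - J.lam w D 0))) := by
      refine ((h1.mul_left (φ (m + 1))).add ((h2.sub h1).mul_left a)).congr_fun fun k => ?_
      change J.lam w D (k + 1) * (φ (m + 1) + a * ((D (k + 1)).card - 1)) = _
      ring
    have h4 := (hasSum_nat_add_iff (f := g) 1).mp h3
    have h5 : φ (m + 1) = φ m + K ^ (R - (m + 1)) := potential_succ K R m
    have h6 : ∑ i ∈ Finset.range 1, g i = J.lam w D 0 * φ m := Finset.sum_range_one _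
    rw [h6] at h4
    have h7 : φ (m + 1) + (a * (β - 1 + J.lam w D 0) - K ^ (R - (m + 1)) * J.lam w D 0) =
        φ (m + 1) * (1 - J.lam w D 0) + a * (β - (1 - J.lam w D 0)) + J.lam w D 0 * φ m := by
      rw [h5]; ring
    rw [h7]
    exact h4
  refine ⟨hgsum.nonneg hg0, ?_⟩
  rw [← hgsum.tsum_eq, ENNReal.ofReal_tsum_of_nonneg hg0 hgsum.summable]
  refine ENNReal.tsum_le_tsum fun k => ?_
  change ENNReal.ofReal (J.lam w D k) * _ ≤ _
  rw [← ENNReal.ofReal_mul (hl k)]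
  refine ENNReal.ofReal_le_ofReal ?_
  cases k with
  | zero =>
    change _ ≤ J.lam w D 0 * φ m
    have : (advance B C (w, 0)).card = m := by
      simp [advance, Finset.card_erase_of_mem hw, hC]
    rw [this]
  | succ k =>
    change _ ≤ J.lam w D (k + 1) * (φ (m + 1) + a * ((D (k + 1)).card - 1))
    refine mul_le_mul_of_nonneg_left ?_ (hl _)
    -- The vertex `w` belongs to both sets, so at most `|B_w(k)| - 1` points are added.
    have hle : (advance B C (w, k + 1)).card ≤ m + 1 + ((D (k + 1)).card - 1) := by
      have h1 := Finset.card_union_add_card_inter C (D (k + 1))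
      have h2 : 1 ≤ (C ∩ D (k + 1)).card :=
        Finset.card_pos.mpr ⟨w, Finset.mem_inter.mpr ⟨hw, hwD _⟩⟩
      have h3 : (advance B C (w, k + 1)).card = (C ∪ D (k + 1)).card := by
        simp [advance, hD]
      omega
    refine (potential_mono hK R hle).trans ((potential_add_le hK R _ _).trans ?_)
    rw [Nat.cast_sub (Finset.card_pos.mpr ⟨w, hwD _⟩)]
    simp [ha, φ]

/-- Averages of functions of the selected vertex. -/
lemma tsum_vertexLaw_mul_le (J : Interaction d) {C : Finset (Vertex d)} (hC : C.Nonempty)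
    {f : Vertex d → ℝ≥0∞} {g : Vertex d → ℝ} {c : ℝ} (hf : ∀ w ∈ C, f w ≤ ENNReal.ofReal (g w))
    (hg : ∀ w ∈ C, 0 ≤ g w) (hc : ∑ w ∈ C, J.mass w * g w ≤ c * ∑ w ∈ C, J.mass w) :
    ∑' w, J.vertexLaw C hC w * f w ≤ ENNReal.ofReal c := by
  have hpos : 0 < ∑ z ∈ C, J.mass z := Finset.sum_pos (fun z _ => J.mass_pos z) hC
  have hsupp : ∀ w ∉ C, J.vertexLaw C hC w * f w = 0 := fun w hw => by
    simp [vertexLaw, hw]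
  rw [tsum_eq_sum hsupp]
  calc ∑ w ∈ C, J.vertexLaw C hC w * f w
      ≤ ∑ w ∈ C, ENNReal.ofReal ((J.mass w / ∑ z ∈ C, J.mass z) * g w) := by
        refine Finset.sum_le_sum fun w hw => ?_
        rw [ENNReal.ofReal_mul (div_nonneg (J.mass_pos w).le hpos.le)]
        have : J.vertexLaw C hC w = ENNReal.ofReal (J.mass w / ∑ z ∈ C, J.mass z) := by
          simp [vertexLaw, hw]
        rw [this]
        exact mul_le_mul' le_rfl (hf w hw)
    _ = ENNReal.ofReal (∑ w ∈ C, (J.mass w / ∑ z ∈ C, J.mass z) * g w) := by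
        rw [ENNReal.ofReal_sum_of_nonneg fun w hw =>
          mul_nonneg (div_nonneg (J.mass_pos w).le hpos.le) (hg w hw)]
    _ ≤ ENNReal.ofReal c := by
        refine ENNReal.ofReal_le_ofReal ?_
        simp only [div_mul_eq_mul_div]
        rw [← Finset.sum_div, div_le_iff₀ hpos]
        exact hc

lemma ConditionH2For.exists_bounds {J : Interaction d} {B : ∀ v, J.Growth v}
    (h : J.ConditionH2For B) : ∃ (Λ : Finset (Vertex d)) (r b : ℝ), 0 ≤ r ∧ r < 1 ∧ 0 ≤ b ∧
      (∀ v, (J.birthSum v (B v).seq).toReal ≤ b) ∧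
      ∀ v ∉ Λ, (J.birthSum v (B v).seq).toReal ≤ r := by
  obtain ⟨hfin, ℓ, hℓ, hlim⟩ := h
  obtain ⟨q, hq1, hq2⟩ := exists_between hℓ
  obtain ⟨Λ, hΛ⟩ := (hlim.eventually_lt_const hq1).exists
  have hout : ∀ v ∉ Λ, (J.birthSum v (B v).seq).toReal ≤ q.toReal := fun v hv =>
    ENNReal.toReal_mono (hq2.trans ENNReal.one_lt_top).ne
      ((le_iSup₂ (f := fun v (_ : v ∉ Λ) => J.birthSum v (B v).seq) v hv).trans hΛ.le)
  have hq : q.toReal < 1 := by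
    have := (ENNReal.toReal_lt_toReal (hq2.trans ENNReal.one_lt_top).ne ENNReal.one_ne_top).mpr hq2
    simpa using this
  have hs : 0 ≤ ∑ v ∈ Λ, (J.birthSum v (B v).seq).toReal :=
    Finset.sum_nonneg fun _ _ => ENNReal.toReal_nonneg
  refine ⟨Λ, q.toReal, 1 + ∑ v ∈ Λ, (J.birthSum v (B v).seq).toReal, ENNReal.toReal_nonneg, hq,
    by linarith, fun v => ?_, hout⟩
  by_cases hv : v ∈ Λ
  · have := Finset.single_le_sum (f := fun v => (J.birthSum v (B v).seq).toReal)
      (fun _ _ => ENNReal.toReal_nonneg) hv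
    linarith
  · linarith [hout v hv]

/-- Under (H2) a suitable potential decreases on average, whatever the current nonempty set is.
In a large set, most of the mass lies at vertices whose mean number of offspring is less than one;
in a small set, the steepness of the potential makes the deaths prevail. -/
lemma ConditionH2For.exists_potential {J : Interaction d} {B : ∀ v, J.Growth v}
    (h : J.ConditionH2For B) : ∃ (K : ℝ) (R : ℕ) (ε : ℝ), 0 < ε ∧
      ∀ (C₀ : Finset (Vertex d)) (l : Sketch d), (clan B C₀ l).Nonempty →
        ∫⁻ l', ENNReal.ofReal (potential K R (clan B C₀ l').card) ∂(sketchKernel B C₀ l) +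
          ENNReal.ofReal ε ≤ ENNReal.ofReal (potential K R (clan B C₀ l).card) := by
  classical
  obtain ⟨Λ, r, b, hr0, hr1, hb0, hb, hr⟩ := h.exists_bounds
  obtain ⟨s, hs⟩ := J.exists_absSum_star_le
  set q := Real.exp (-2 * s) with hq
  have hq0 : 0 < q := Real.exp_pos _
  obtain ⟨R, hR⟩ := exists_nat_ge (Λ.card * (2 * Real.exp s) * b / (1 - r))
  set K := 1 + b / q with hKdef
  have hK : 1 ≤ K := by
    have : 0 ≤ b / q := div_nonneg hb0 hq0.le
    linarith
  refine ⟨K, R, (1 - r) / 2, by linarith, fun C₀ l hC => ?_⟩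
  rw [lintegral_sketchKernel_of_nonempty B C₀ l hC]
  simp only [clan_snoc]
  set C := clan B C₀ l
  obtain ⟨m, hm⟩ : ∃ m, C.card = m + 1 := Nat.exists_eq_succ_of_ne_zero (Finset.card_pos.mpr hC).ne'
  have key := fun w (hw : w ∈ C) => tsum_lamLaw_mul_potential_le B hK R hm hw (h.1 w)
  set δ : Vertex d → ℝ := fun w => K ^ (R - (m + 2)) * ((J.birthSum w (B w).seq).toReal - 1 +
        J.lam w (B w).seq 0) - K ^ (R - (m + 1)) * J.lam w (B w).seq 0 with hδ
  have hmass : ∀ w, 2 ≤ J.mass w ∧ J.mass w ≤ 2 * Real.exp s := fun w => by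
    have h1 := Real.one_le_exp (J.absSum_nonneg (star w))
    have h2 := Real.exp_le_exp.mpr (hs w)
    unfold mass
    constructor <;> linarith
  have hlam : ∀ w, q ≤ J.lam w (B w).seq 0 := fun w => by
    simp only [lam, hq]
    exact Real.exp_le_exp.mpr (by linarith [hs w])
  have hdrift : ∑ w ∈ C, J.mass w * δ w ≤ -((1 - r) / 2) * ∑ w ∈ C, J.mass w := by
    rcases Nat.lt_or_ge (m + 1) R with hmR | hmR
    · rw [Finset.mul_sum]
      refine Finset.sum_le_sum fun w _ => ?_
      rw [mul_comm]
      refine mul_le_mul_of_nonneg_right ?_ (J.mass_pos w).le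
      have hpow : K ^ (R - (m + 1)) = K ^ (R - (m + 2)) * K := by
        rw [← pow_succ]; congr 1; omega
      have ha : 1 ≤ K ^ (R - (m + 2)) := one_le_pow₀ hK
      have h1 : b ≤ b / q * J.lam w (B w).seq 0 := by
        rw [div_mul_eq_mul_div, le_div_iff₀ hq0]
        exact mul_le_mul_of_nonneg_left (hlam w) hb0
      have h2 : δ w = K ^ (R - (m + 2)) * ((J.birthSum w (B w).seq).toReal - 1 -
          b / q * J.lam w (B w).seq 0) := by
        simp only [hδ]
        rw [hpow]
        simp only [hKdef]
        ring
      rw [h2]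
      have h3 := hb w
      nlinarith
    · have h1 : ∀ w, δ w = (J.birthSum w (B w).seq).toReal - 1 := fun w => by
        simp only [hδ]
        rw [Nat.sub_eq_zero_of_le hmR, Nat.sub_eq_zero_of_le (by omega)]
        ring
      have h2 : ∀ w ∈ C, J.mass w * δ w ≤
          -(1 - r) * J.mass w + if w ∈ Λ then 2 * Real.exp s * b else 0 := by
        intro w _
        rw [h1 w]
        have hM := hmass w
        split_ifs with hw
        · have h3 := hb w
          nlinarith
        · have h3 := hr w hw
          nlinarith
      have h3 : ∑ w ∈ C, (if w ∈ Λ then 2 * Real.exp s * b else 0) ≤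
          Λ.card * (2 * Real.exp s * b) := by
        rw [← Finset.sum_filter, Finset.sum_const, nsmul_eq_mul]
        refine mul_le_mul_of_nonneg_right ?_ (by positivity)
        exact_mod_cast Finset.card_le_card fun w hw => (Finset.mem_filter.mp hw).2
      have h4 : (2 : ℝ) * R ≤ ∑ w ∈ C, J.mass w := by
        calc (2 : ℝ) * R ≤ ∑ w ∈ C, (2 : ℝ) := by
              rw [Finset.sum_const, nsmul_eq_mul, hm, mul_comm]
              have : (R : ℝ) ≤ ((m + 1 : ℕ) : ℝ) := by exact_mod_cast hmR
              linarith
          _ ≤ _ := Finset.sum_le_sum fun w _ => (hmass w).1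
      rw [div_le_iff₀ (by linarith)] at hR
      have h5 := Finset.sum_le_sum h2
      rw [Finset.sum_add_distrib, ← Finset.mul_sum] at h5
      nlinarith
  have hε0 : 0 ≤ (1 - r) / 2 := by linarith
  have hmain := J.tsum_vertexLaw_mul_le hC (g := fun w => potential K R (m + 1) + δ w)
    (c := potential K R (m + 1) - (1 - r) / 2) (fun w hw => (key w hw).2)
    (fun w hw => (key w hw).1) (by
      simp only [mul_add]
      rw [Finset.sum_add_distrib, ← Finset.sum_mul]
      linarith)
  have hc0 : 0 ≤ potential K R (m + 1) - (1 - r) / 2 := by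
    have h1 : 1 ≤ potential K R (m + 1) := by
      rw [potential_succ]
      have := potential_nonneg hK R m
      have h2 : 1 ≤ K ^ (R - (m + 1)) := one_le_pow₀ hK
      linarith
    linarith
  calc _ ≤ ENNReal.ofReal (potential K R (m + 1) - (1 - r) / 2) + ENNReal.ofReal ((1 - r) / 2) :=
        add_le_add_left hmain _
    _ = _ := by rw [← ENNReal.ofReal_add hc0 hε0, hm]; congr 1; ring

lemma ConditionH2For.extinction {J : Interaction d} {B : ∀ v, J.Growth v}
    (h : J.ConditionH2For B) (C₀ : Finset (Vertex d)) :
    (∑' n, sketchMeasure B C₀ {ω | sketchProcess B C₀ n ω ≠ ∅} ≠ ⊤) ∧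
      ∀ᵐ ω ∂(sketchMeasure B C₀), ∀ᶠ n in atTop, sketchProcess B C₀ n ω = ∅ := by
  obtain ⟨K, R, ε, hε, hV⟩ := h.exists_potential
  exact ae_eventually_sketchProcess_eq_empty B C₀
    (V := fun l => ENNReal.ofReal (potential K R (clan B C₀ l).card)) (ε := ENNReal.ofReal ε)
    (by simpa using hε) ENNReal.ofReal_ne_top (hV C₀)

/-! ### Existence of a Gibbs measure -/

/-- The finite sets that meet `Λ`. -/
def touching (Λ : Finset (Vertex d)) : Set (Finset (Vertex d)) := {A | ∃ u ∈ Λ, u ∈ A}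

lemma summable_touching (J : Interaction d) (Λ : Finset (Vertex d)) :
    Summable fun A : touching Λ => |J.coupling A| := by
  refine (summable_subtype_iff_indicator (f := fun A => |J.coupling A|)).mpr ?_
  have h1 : Summable fun A => ∑ u ∈ Λ, (star u).indicator (fun A => |J.coupling A|) A :=
    summable_sum fun u _ => summable_subtype_iff_indicator.mp (J.summable_star u)
  refine Summable.of_nonneg_of_le (fun A => Set.indicator_nonneg (fun _ _ => abs_nonneg _) _)
    (fun A => ?_) h1
  have h0 : ∀ u ∈ Λ, 0 ≤ (star u).indicator (fun A => |J.coupling A|) A := fun u _ =>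
    Set.indicator_nonneg (fun _ _ => abs_nonneg _) _
  by_cases hA : A ∈ touching Λ
  · obtain ⟨u, hu, huA⟩ := hA
    rw [Set.indicator_of_mem (show A ∈ touching Λ from ⟨u, hu, huA⟩)]
    refine le_trans ?_ (Finset.single_le_sum h0 hu)
    rw [Set.indicator_of_mem (show A ∈ star u from huA)]
  · rw [Set.indicator_of_notMem hA]
    exact Finset.sum_nonneg h0

/-- The energy in the box `Λ` splits into the energy at `v ∈ Λ` and a part that does not depend on
the spin at `v`. -/
lemma spinSum_touching_update (J : Interaction d) {Λ : Finset (Vertex d)} {v : Vertex d}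
    (hv : v ∈ Λ) (σ : Config d) (a : ℤˣ) :
    J.spinSum (touching Λ) (Function.update σ v a) =
      J.siteEnergy v (Function.update σ v a) + J.spinSum (touching Λ \ star v) σ := by
  have hsub : star v ⊆ touching Λ := fun A hA => ⟨v, hv, hA⟩
  have hrest : Summable fun A : ↥(touching Λ \ star v) => |J.coupling A| := by
    have h1 := (summable_subtype_iff_indicator (f := fun A => |J.coupling A|)).mp
      (J.summable_touching Λ)
    refine (summable_subtype_iff_indicator (f := fun A => |J.coupling A|)).mpr ?_
    refine h1.of_nonneg_of_le (fun A => Set.indicator_nonneg (fun _ _ => abs_nonneg _) _)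
      fun A => ?_
    exact Set.indicator_le_indicator_of_subset Set.sdiff_subset (fun _ => abs_nonneg _) A
  have hd : Disjoint (star v) (touching Λ \ star v) :=
    Set.disjoint_left.mpr fun _ h h' => h'.2 h
  have h1 := J.spinSum_union (J.summable_star v) hrest hd (Function.update σ v a)
  have h2 : star v ∪ (touching Λ \ star v) = touching Λ := by
    ext A
    simp only [Set.mem_union, Set.mem_sdiff]
    exact ⟨fun h => h.elim (fun h => hsub h) fun h => h.1, fun h => by tauto⟩
  rw [h2] at h1
  rw [h1, siteEnergy]
  congr 1
  refine tsum_congr fun A => ?_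
  have hA : ∀ u ∈ A.1, Function.update σ v a u = σ u := fun u hu => by
    rw [Function.update_of_ne]
    rintro rfl
    exact A.2.2 hu
  rw [chi_congr hA]

open Classical in
/-- The configuration with spins `τ` in `Λ` and `1` outside. -/
noncomputable def plusOutside (Λ : Finset (Vertex d)) (τ : Λ → ℤˣ) : Config d :=
  fun u => if h : u ∈ Λ then τ ⟨u, h⟩ else 1

/-- The Boltzmann weight in the box `Λ`, with plus boundary condition. -/
noncomputable def boltzmann (J : Interaction d) (Λ : Finset (Vertex d)) (τ : Λ → ℤˣ) : ℝ :=
  Real.exp (J.spinSum (touching Λ) (plusOutside Λ τ))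

lemma boltzmann_pos (J : Interaction d) (Λ : Finset (Vertex d)) (τ : Λ → ℤˣ) :
    0 < J.boltzmann Λ τ := Real.exp_pos _

lemma boltzmann_sum_pos (J : Interaction d) (Λ : Finset (Vertex d)) :
    0 < ∑ τ, J.boltzmann Λ τ :=
  Finset.sum_pos (fun _ _ => Real.exp_pos _) Finset.univ_nonempty

/-- The finite-volume Gibbs law in the box `Λ`. -/
noncomputable def boxLaw (J : Interaction d) (Λ : Finset (Vertex d)) : PMF (Λ → ℤˣ) :=
  PMF.ofFintype (fun τ => ENNReal.ofReal (J.boltzmann Λ τ / ∑ τ, J.boltzmann Λ τ)) (by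
    rw [← ENNReal.ofReal_sum_of_nonneg fun τ _ =>
      div_nonneg (J.boltzmann_pos Λ _).le (J.boltzmann_sum_pos Λ).le, ← Finset.sum_div,
      div_self (J.boltzmann_sum_pos Λ).ne', ENNReal.ofReal_one])

/-- The finite-volume Gibbs measure in the box `Λ`, with plus boundary condition. -/
noncomputable def boxMeasure (J : Interaction d) (Λ : Finset (Vertex d)) :
    ProbabilityMeasure (Config d) :=
  ⟨(J.boxLaw Λ).toMeasure.map (plusOutside Λ),
    Measure.isProbabilityMeasure_map (Measurable.of_discrete).aemeasurable⟩

lemma integral_boxMeasure (J : Interaction d) (Λ : Finset (Vertex d)) {f : Config d → ℝ}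
    (hf : Continuous f) :
    ∫ σ, f σ ∂(J.boxMeasure Λ : Measure (Config d)) =
      ∑ τ, J.boltzmann Λ τ / (∑ τ, J.boltzmann Λ τ) * f (plusOutside Λ τ) := by
  change ∫ σ, f σ ∂((J.boxLaw Λ).toMeasure.map (plusOutside Λ)) = _
  rw [integral_map Measurable.of_discrete.aemeasurable hf.measurable.aestronglyMeasurable,
    PMF.integral_eq_sum]
  refine Finset.sum_congr rfl fun τ _ => ?_
  rw [boxLaw, PMF.ofFintype_apply, ENNReal.toReal_ofReal
    (div_nonneg (J.boltzmann_pos Λ _).le (J.boltzmann_sum_pos Λ).le), smul_eq_mul]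

/-- The defect of the Gibbs property at `v`, tested against a function of the other spins. -/
noncomputable def gibbsDefect (J : Interaction d) (v : Vertex d) (a : ℤˣ)
    (g : ({u : Vertex d // u ≠ v} → ℤˣ) → ℝ) (σ : Config d) : ℝ :=
  g (out v σ) * ((if σ v = a then 1 else 0) - J.siteProb v a σ)

lemma continuous_spin_eq (v : Vertex d) (a : ℤˣ) :
    Continuous fun σ : Config d => if σ v = a then (1 : ℝ) else 0 :=
  (continuous_of_discreteTopology (f := fun x : ℤˣ => if x = a then (1 : ℝ) else 0)).comp
    (continuous_apply v)

lemma continuous_gibbsDefect (J : Interaction d) (v : Vertex d) (a : ℤˣ)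
    {g : ({u : Vertex d // u ≠ v} → ℤˣ) → ℝ} (hg : Continuous g) :
    Continuous (J.gibbsDefect v a g) :=
  (hg.comp (continuous_out v)).mul ((continuous_spin_eq v a).sub (J.continuous_siteProb v a))

lemma siteProb_update (J : Interaction d) (v : Vertex d) (a b : ℤˣ) (σ : Config d) :
    J.siteProb v a (Function.update σ v b) = J.siteProb v a σ := by
  simp [siteProb]

/-- The two configurations that differ at `v` only contribute opposite amounts. -/
lemma exp_mul_gibbsDefect_update_neg (J : Interaction d) {Λ : Finset (Vertex d)} {v : Vertex d}
    (hv : v ∈ Λ) (a b : ℤˣ) (g : ({u : Vertex d // u ≠ v} → ℤˣ) → ℝ) (σ : Config d) :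
    Real.exp (J.spinSum (touching Λ) (Function.update σ v b)) *
        J.gibbsDefect v a g (Function.update σ v b) +
      Real.exp (J.spinSum (touching Λ) (Function.update σ v (-b))) *
        J.gibbsDefect v a g (Function.update σ v (-b)) = 0 := by
  wlog hb : b = a generalizing b
  · have hb' : -b = a := by
      rcases Int.units_eq_one_or a with h | h <;> rcases Int.units_eq_one_or b with h' | h' <;>
        simp_all
    have := this (-b) hb'
    rw [neg_neg] at this
    linarith
  subst hb
  have hne : -b ≠ b := by rcases Int.units_eq_one_or b with h | h <;> rw [h] <;> decide
  simp only [gibbsDefect, out_update, siteProb_update, Function.update_self, if_true, if_neg hne,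
    J.spinSum_touching_update hv, siteEnergy_update_neg, Real.exp_add]
  rw [siteProb]
  set E := J.siteEnergy v (Function.update σ v b)
  set c := Real.exp (J.spinSum (touching Λ \ star v) σ)
  have e1 : Real.exp (-2 * E) = Real.exp (-E) * Real.exp (-E) := by rw [← Real.exp_add]; ring_nf
  have e3 : Real.exp E * Real.exp (-E) = 1 := by rw [← Real.exp_add]; simp
  have p1 : 0 < 1 + Real.exp (-E) * Real.exp (-E) := by positivity
  rw [e1]
  field_simp
  linear_combination (c * g (out v σ) * Real.exp (-E)) * e3

lemma integral_gibbsDefect_boxMeasure (J : Interaction d) {Λ : Finset (Vertex d)} {v : Vertex d}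
    (hv : v ∈ Λ) (a : ℤˣ) {g : ({u : Vertex d // u ≠ v} → ℤˣ) → ℝ} (hg : Continuous g) :
    ∫ σ, J.gibbsDefect v a g σ ∂(J.boxMeasure Λ : Measure (Config d)) = 0 := by
  classical
  rw [J.integral_boxMeasure Λ (J.continuous_gibbsDefect v a hg)]
  simp only [div_mul_eq_mul_div]
  rw [← Finset.sum_div]
  have hflip : ∀ τ : Λ → ℤˣ, plusOutside Λ (Function.update τ ⟨v, hv⟩ (-τ ⟨v, hv⟩)) =
      Function.update (plusOutside Λ τ) v (-τ ⟨v, hv⟩) := by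
    intro τ
    funext u
    by_cases hu : u = v
    · subst hu; simp [plusOutside, hv]
    · by_cases huΛ : u ∈ Λ
      · simp [plusOutside, huΛ, hu]
      · simp [plusOutside, huΛ, hu]
  have hself : ∀ τ : Λ → ℤˣ, Function.update (plusOutside Λ τ) v (τ ⟨v, hv⟩) =
      plusOutside Λ τ := fun τ => by
    rw [Function.update_eq_self_iff]
    simp [plusOutside, hv]
  have hsum : ∑ τ, J.boltzmann Λ τ * J.gibbsDefect v a g (plusOutside Λ τ) = 0 := by
    refine Finset.sum_involution
      (fun τ _ => Function.update τ ⟨v, hv⟩ (-τ ⟨v, hv⟩)) (fun τ _ => ?_) (fun τ _ _ h => ?_)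
      (fun _ _ => Finset.mem_univ _) (fun τ _ => ?_)
    · have h := J.exp_mul_gibbsDefect_update_neg hv a (τ ⟨v, hv⟩) g (plusOutside Λ τ)
      rw [hself] at h
      simpa only [boltzmann, hflip] using h
    · have h1 := congrFun h ⟨v, hv⟩
      rw [Function.update_self] at h1
      rcases Int.units_eq_one_or (τ ⟨v, hv⟩) with h2 | h2 <;> rw [h2] at h1 <;>
        exact absurd h1 (by decide)
    · simp
  rw [hsum, zero_div]

lemma isGibbs_of_integral_gibbsDefect (J : Interaction d) (π : Measure (Config d))
    [IsProbabilityMeasure π]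
    (h : ∀ (v : Vertex d) (a : ℤˣ) (g : ({u : Vertex d // u ≠ v} → ℤˣ) → ℝ), Continuous g →
      ∫ σ, J.gibbsDefect v a g σ ∂π = 0) : J.IsGibbs π := by
  refine (J.isGibbs_iff π).mpr ⟨inferInstance, fun v a => ?_⟩
  have hfin : IsFiniteMeasure (π.withDensity fun σ => ENNReal.ofReal (J.siteProb v a σ)) :=
    isFiniteMeasure_withDensity_ofReal (J.integrable_siteProb v a π).2
  refine ext_of_forall_integral_eq_of_IsFiniteMeasure fun g => ?_
  have hmo := (measurable_out v).aemeasurable (μ := π.restrict {σ | σ v = a})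
  have hgm := g.continuous.measurable
  have hgo : Continuous fun σ : Config d => g (out v σ) := g.continuous.comp (continuous_out v)
  rw [integral_map hmo hgm.aestronglyMeasurable,
    integral_map (measurable_out v).aemeasurable hgm.aestronglyMeasurable,
    integral_withDensity_eq_integral_toReal_smul
      (J.continuous_siteProb v a).measurable.ennreal_ofReal (ae_of_all _ fun _ => by simp)]
  have hint : ∀ {f : Config d → ℝ}, Continuous f → Integrable f π := fun {f} hf => by
    obtain ⟨c, hc⟩ := isCompact_univ.exists_bound_of_continuousOn hf.continuousOn
    exact Integrable.of_bound hf.measurable.aestronglyMeasurable c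
      (ae_of_all _ fun σ => hc σ (Set.mem_univ σ))
  have h1 := h v a g g.continuous
  simp only [gibbsDefect, mul_sub] at h1
  have hi1 : Integrable (fun σ => g (out v σ) * if σ v = a then 1 else 0) π :=
    hint (hgo.mul (continuous_spin_eq v a))
  have hi2 : Integrable (fun σ => g (out v σ) * J.siteProb v a σ) π :=
    hint (hgo.mul (J.continuous_siteProb v a))
  rw [integral_sub hi1 hi2, sub_eq_zero] at h1
  rw [← integral_indicator (measurableSet_spin_eq v a)]
  convert h1 using 2
  · funext σ
    by_cases hσ : σ v = a <;> simp [hσ]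
  · funext σ
    rw [ENNReal.toReal_ofReal (J.siteProb_nonneg v a σ), smul_eq_mul, mul_comm]

/-- Every weak limit of the finite-volume Gibbs measures is a Gibbs measure. -/
lemma exists_isGibbs (J : Interaction d) : ∃ π : Measure (Config d), J.IsGibbs π := by
  let U : Ultrafilter (Finset (Vertex d)) := Ultrafilter.of atTop
  obtain ⟨π, -, hπ⟩ := isCompact_univ.ultrafilter_le_nhds (U.map J.boxMeasure) (by simp)
  have hlim : Tendsto J.boxMeasure U (𝓝 π) := hπ
  rw [ProbabilityMeasure.tendsto_iff_forall_integral_tendsto] at hlim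
  refine ⟨π, J.isGibbs_of_integral_gibbsDefect π fun v a g hg => ?_⟩
  have h1 := hlim (BoundedContinuousFunction.mkOfCompact
    ⟨J.gibbsDefect v a g, J.continuous_gibbsDefect v a hg⟩)
  simp only [BoundedContinuousFunction.mkOfCompact_apply, ContinuousMap.coe_mk] at h1
  refine tendsto_nhds_unique h1 (tendsto_const_nhds.congr' ?_)
  have h2 : ∀ᶠ Λ in (U : Filter (Finset (Vertex d))), {v} ≤ Λ :=
    (Ultrafilter.of_le atTop) (eventually_ge_atTop ({v} : Finset (Vertex d)))
  filter_upwards [h2] with Λ hΛ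
  exact (J.integral_gibbsDefect_boxMeasure (Finset.singleton_subset_iff.mp hΛ) a hg).symm

/-! ### Comparison of the conditions (H1) and (H2) -/

lemma mem_ball {u v : Vertex d} {k : ℕ} : u ∈ ball v k ↔ ∑ i, (u i - v i).natAbs ≤ k := by
  unfold ball
  rw [Finset.mem_filter, Finset.mem_Icc, and_iff_right_iff_imp]
  intro h
  have h1 : ∀ i, (u i - v i).natAbs ≤ k := fun i =>
    (Finset.single_le_sum (f := fun i => (u i - v i).natAbs) (fun _ _ => Nat.zero_le _)
      (Finset.mem_univ i)).trans h
  constructor <;> intro i <;> have := h1 i <;> simp only <;> omega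

/-- The vertex `v + j e_i`. -/
def shift (i : Fin d) (j : ℤ) (v : Vertex d) : Vertex d := Function.update v i (v i + j)

lemma shift_mem_ball (i : Fin d) (j : ℤ) (v : Vertex d) (k : ℕ) :
    shift i j v ∈ ball v k ↔ j.natAbs ≤ k := by
  rw [mem_ball, Finset.sum_eq_single i]
  · simp [shift]
  · intro b _ hb
    simp [shift, hb]
  · simp

lemma shift_injective (i : Fin d) (v : Vertex d) : Function.Injective fun j => shift i j v := by
  intro j j' h
  simpa [shift] using congrFun h i

lemma shift_shift (i : Fin d) (j j' : ℤ) (v : Vertex d) :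
    shift i j (shift i j' v) = shift i (j' + j) v := by
  simp [shift, add_assoc]

lemma shift_zero (i : Fin d) (v : Vertex d) : shift i 0 v = v := by
  simp [shift]

lemma ball_mono (v : Vertex d) : Monotone (ball v) := fun _ _ h _ hu =>
  mem_ball.mpr ((mem_ball.mp hu).trans h)

lemma ball_ssubset (i : Fin d) (v : Vertex d) {k l : ℕ} (h : k < l) : ball v k ⊂ ball v l := by
  refine Finset.ssubset_iff_of_subset (ball_mono v h.le) |>.mpr ⟨shift i l v, ?_, ?_⟩
  · rw [shift_mem_ball]; simp
  · rw [shift_mem_ball]; simpa using h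

lemma ball_zero (v : Vertex d) : ball v 0 = {v} := by
  ext u
  rw [mem_ball, Finset.mem_singleton, Nat.le_zero, Finset.sum_eq_zero_iff]
  constructor
  · intro h
    funext i
    have := h i (Finset.mem_univ i)
    omega
  · rintro rfl i -
    simp

/-- The growing `ℓ¹` balls around `v`. -/
noncomputable def ballGrowth (J : Interaction d) (i : Fin d) (v : Vertex d) : J.Growth v where
  seq := ball v
  seq_zero := ball_zero v
  seq_succ k := ball_ssubset i v k.lt_succ_self
  cover _ _ _ _ _ := Set.mem_iUnion.mpr ⟨_, mem_ball.mpr le_rfl⟩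

lemma conditionH2For_of_le {J : Interaction d} (B : ∀ v, J.Growth v) {c : ℝ≥0∞} (hc : c < 1)
    (h : ∀ v, J.birthSum v (B v).seq ≤ c) : J.ConditionH2For B := by
  refine ⟨fun v => ((h v).trans_lt hc).trans ENNReal.one_lt_top, _, ?_, tendsto_atTop_iInf ?_⟩
  · exact ((iInf_le _ ∅).trans (iSup₂_le fun v _ => h v)).trans_lt hc
  · intro Λ Λ' hΛ
    exact iSup₂_le fun v hv => le_iSup₂ (f := fun v (_ : v ∉ Λ) => J.birthSum v (B v).seq) v
      fun h => hv (hΛ h)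

lemma ConditionH1.conditionH2 {J : Interaction d} (hd : 0 < d) (h : J.ConditionH1) :
    J.ConditionH2 :=
  ⟨J.ballGrowth ⟨0, hd⟩, conditionH2For_of_le _ h fun v =>
    le_iSup (fun v : Vertex d => J.birthSum v (ball v)) v⟩

/-- The pair `{u, u + 5 e_i}`. -/
noncomputable def bond (i : Fin d) (u : Vertex d) : Finset (Vertex d) := {u, shift i 5 u}

lemma card_bond (i : Fin d) (u : Vertex d) : (bond i u).card = 2 := by
  refine Finset.card_pair fun h => ?_
  have := shift_injective i u ((shift_zero i u).trans h)
  omega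

lemma mem_bond_iff (i : Fin d) (u v : Vertex d) :
    v ∈ bond i u ↔ u = v ∨ u = shift i (-5) v := by
  rw [bond, Finset.mem_insert, Finset.mem_singleton]
  constructor
  · rintro (h | h)
    · exact Or.inl h.symm
    · right; rw [h, shift_shift]; simp [shift_zero]
  · rintro (h | h)
    · exact Or.inl h.symm
    · right; rw [h, shift_shift]; simp [shift_zero]

lemma bond_ne (i : Fin d) (v : Vertex d) : bond i v ≠ bond i (shift i (-5) v) := by
  intro h
  have h1 : shift i 5 v ∈ bond i (shift i (-5) v) := by
    rw [← h]; simp [bond]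
  rw [bond, Finset.mem_insert, Finset.mem_singleton, shift_shift] at h1
  rcases h1 with h1 | h1
  · have := shift_injective i v h1; omega
  · have := shift_injective i v h1; omega

open Classical in
/-- The coupling constants of a pair interaction between the vertices `u` and `u + 5 e_i`. -/
noncomputable def bondCoupling (i : Fin d) (β : ℝ) (A : Finset (Vertex d)) : ℝ :=
  if ∃ u, A = bond i u then β else 0

lemma bondCoupling_bond (i : Fin d) (β : ℝ) (u : Vertex d) : bondCoupling i β (bond i u) = β :=
  if_pos ⟨u, rfl⟩

lemma bondCoupling_eq_zero {i : Fin d} {β : ℝ} {v : Vertex d} {A : Finset (Vertex d)} (hv : v ∈ A)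
    (h1 : A ≠ bond i v) (h2 : A ≠ bond i (shift i (-5) v)) : bondCoupling i β A = 0 := by
  refine if_neg ?_
  rintro ⟨u, rfl⟩
  rcases (mem_bond_iff i u v).mp hv with rfl | rfl
  · exact h1 rfl
  · exact h2 rfl

/-- The translation-invariant pair interaction of strength `β` between the vertices `u` and
`u + 5 e_i`. -/
noncomputable def bondInteraction (i : Fin d) (β : ℝ) : Interaction d where
  coupling := bondCoupling i β
  coupling_small A hA := by
    refine if_neg ?_
    rintro ⟨u, rfl⟩
    rw [card_bond] at hA
    omega
  bounded := by
    classical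
    refine (iSup_le fun v => ?_).trans_lt
      (b := ENNReal.ofReal (2 * |β|) + ENNReal.ofReal (2 * |β|))
      (ENNReal.add_lt_top.mpr ⟨ENNReal.ofReal_lt_top, ENNReal.ofReal_lt_top⟩)
    change ∑' A : star v, ENNReal.ofReal (A.1.card * |bondCoupling i β A.1|) ≤ _
    rw [tsum_subtype (star v) fun A => ENNReal.ofReal (A.card * |bondCoupling i β A|),
      tsum_eq_sum (s := {bond i v, bond i (shift i (-5) v)})]
    · rw [Finset.sum_pair (bond_ne i v)]
      refine add_le_add ?_ ?_ <;> refine (Set.indicator_le_self _ _ _).trans ?_ <;>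
        simp [card_bond, bondCoupling_bond]
    · intro A hA
      simp only [Finset.mem_insert, Finset.mem_singleton, not_or] at hA
      by_cases hv : A ∈ star v
      · rw [Set.indicator_of_mem hv, bondCoupling_eq_zero hv hA.1 hA.2]; simp
      · exact Set.indicator_of_notMem hv _

lemma bondInteraction_absSum (i : Fin d) {β : ℝ} (hβ : 0 ≤ β) {v : Vertex d}
    {𝒜 : Set (Finset (Vertex d))} (h𝒜 : 𝒜 ⊆ star v) :
    (bondInteraction i β).absSum 𝒜 = 𝒜.indicator (fun _ => β) (bond i v) +
      𝒜.indicator (fun _ => β) (bond i (shift i (-5) v)) := by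
  classical
  have h1 : (bondInteraction i β).absSum 𝒜 = ∑' A, 𝒜.indicator (fun A => |bondCoupling i β A|) A :=
    tsum_subtype 𝒜 fun A => |bondCoupling i β A|
  rw [h1, tsum_eq_sum (s := {bond i v, bond i (shift i (-5) v)}), Finset.sum_pair (bond_ne i v)]
  · simp only [Set.indicator, bondCoupling_bond, abs_of_nonneg hβ]
  · intro A hA
    simp only [Finset.mem_insert, Finset.mem_singleton, not_or] at hA
    by_cases hv : A ∈ 𝒜
    · rw [Set.indicator_of_mem hv, bondCoupling_eq_zero (h𝒜 hv) hA.1 hA.2, abs_zero]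
    · exact Set.indicator_of_notMem hv _

lemma bond_mem_star (i : Fin d) (v : Vertex d) :
    bond i v ∈ star v ∧ bond i (shift i (-5) v) ∈ star v :=
  ⟨(mem_bond_iff i _ _).mpr (Or.inl rfl), (mem_bond_iff i _ _).mpr (Or.inr rfl)⟩

lemma bondInteraction_absSum_star (i : Fin d) {β : ℝ} (hβ : 0 ≤ β) (v : Vertex d) :
    (bondInteraction i β).absSum (star v) = 2 * β := by
  rw [bondInteraction_absSum i hβ subset_rfl, Set.indicator_of_mem (bond_mem_star i v).1,
    Set.indicator_of_mem (bond_mem_star i v).2]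
  ring

lemma bond_eq_shift (i : Fin d) (v : Vertex d) :
    bond i (shift i (-5) v) = {shift i (-5) v, v} := by
  rw [bond, shift_shift]
  simp [shift_zero]

/-- The interaction at `v` lies inside every set that contains `v` and its two neighbours. -/
lemma bondInteraction_absSum_beyond_eq_zero (i : Fin d) {β : ℝ} (hβ : 0 ≤ β) {v : Vertex d}
    {D : Finset (Vertex d)} (h0 : v ∈ D) (h1 : shift i 5 v ∈ D) (h2 : shift i (-5) v ∈ D) :
    (bondInteraction i β).absSum (beyond v D) = 0 := by
  rw [bondInteraction_absSum i hβ (beyond_subset v D), Set.indicator_of_notMem,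
    Set.indicator_of_notMem, add_zero]
  · rintro ⟨-, h⟩
    rw [bond_eq_shift] at h
    exact h (by simp [Finset.insert_subset_iff, h0, h2])
  · rintro ⟨-, h⟩
    exact h (by simp [bond, Finset.insert_subset_iff, h0, h1])

lemma bondInteraction_absSum_beyond_eq (i : Fin d) {β : ℝ} (hβ : 0 ≤ β) {v : Vertex d}
    {D : Finset (Vertex d)} (h1 : shift i 5 v ∉ D) (h2 : shift i (-5) v ∉ D) :
    (bondInteraction i β).absSum (beyond v D) = 2 * β := by
  rw [bondInteraction_absSum i hβ (beyond_subset v D), Set.indicator_of_mem,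
    Set.indicator_of_mem]
  · ring
  · refine ⟨(bond_mem_star i v).2, fun h => h2 (h ?_)⟩
    simp [bond]
  · refine ⟨(bond_mem_star i v).1, fun h => h1 (h ?_)⟩
    simp [bond]

/-- Sets adapted to the interaction: the first one consists of `v` and its two neighbours, and `ℓ¹`
balls follow. -/
noncomputable def bondSeq (i : Fin d) (v : Vertex d) : ℕ → Finset (Vertex d)
  | 0 => {v}
  | 1 => {v, shift i 5 v, shift i (-5) v}
  | k + 2 => ball v (k + 5)

lemma self_mem_ball (v : Vertex d) (k : ℕ) : v ∈ ball v k := by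
  rw [mem_ball]; simp

lemma mem_bondSeq (i : Fin d) (v : Vertex d) (k : ℕ) : v ∈ bondSeq i v (k + 1) ∧
    shift i 5 v ∈ bondSeq i v (k + 1) ∧ shift i (-5) v ∈ bondSeq i v (k + 1) := by
  cases k with
  | zero => simp [bondSeq]
  | succ k => simp [bondSeq, self_mem_ball, shift_mem_ball]

/-- The sets `bondSeq i v` as an admissible choice for the pair interaction. -/
noncomputable def bondGrowth (i : Fin d) (β : ℝ) (v : Vertex d) :
    (bondInteraction i β).Growth v where
  seq := bondSeq i v
  seq_zero := rfl
  seq_succ k := by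
    have hne : ∀ {j : ℤ}, j ≠ 0 → shift i j v ≠ v := fun hj h =>
      hj (shift_injective i v (h.trans (shift_zero i v).symm))
    match k with
    | 0 =>
      refine Finset.ssubset_iff_of_subset (by simp [bondSeq]) |>.mpr ⟨shift i 5 v, ?_, ?_⟩
      · simp [bondSeq]
      · simpa [bondSeq] using hne (by norm_num)
    | 1 =>
      refine Finset.ssubset_iff_of_subset ?_ |>.mpr ⟨shift i 1 v, ?_, ?_⟩
      · simp [bondSeq, Finset.insert_subset_iff, self_mem_ball, shift_mem_ball]
      · simp [bondSeq, shift_mem_ball]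
      · simp only [bondSeq, Finset.mem_insert, Finset.mem_singleton, not_or]
        refine ⟨hne one_ne_zero, fun h => ?_, fun h => ?_⟩
        · have := shift_injective i v h; omega
        · have := shift_injective i v h; omega
    | k + 2 => exact ball_ssubset i v (by omega)
  cover A hv hA := by
    have h := mem_bondSeq i v 0
    have hsub : A ⊆ bondSeq i v 1 := by
      by_contra hcon
      refine hA (bondCoupling_eq_zero hv ?_ ?_)
      · rintro rfl
        exact hcon (by simp [bond, Finset.insert_subset_iff, h.1, h.2.1])
      · rintro rfl
        rw [bond_eq_shift] at hcon
        exact hcon (by simp [Finset.insert_subset_iff, h.1, h.2.2])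
    exact fun u hu => Set.mem_iUnion.mpr ⟨1, hsub hu⟩

/-- With the adapted sets, at most two points are added, with probability `1 - e^{-4β}`; the balls,
of which the relevant one has at least eleven points, are far less economical. -/
lemma exists_conditionH2_not_conditionH1 (hd : 0 < d) :
    ∃ J : Interaction d, J.ConditionH2 ∧ ¬ J.ConditionH1 := by
  let i : Fin d := ⟨0, hd⟩
  -- Any value of `e^{-2β}` with `2 / 3 < e^{-4β}` and `e^{-2β} ≤ 10 / 11` would do.
  obtain ⟨β, hβ, hexp⟩ : ∃ β : ℝ, 0 ≤ β ∧ Real.exp (-(2 * β)) = 17 / 20 := by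
    refine ⟨-Real.log (17 / 20) / 2, ?_, ?_⟩
    · have := Real.log_nonpos (x := 17 / 20) (by norm_num) (by norm_num)
      linarith
    · rw [show -(2 * (-Real.log (17 / 20) / 2)) = Real.log (17 / 20) by ring,
        Real.exp_log (by norm_num)]
  refine ⟨bondInteraction i β, ⟨bondGrowth i β, ?_⟩, ?_⟩
  · refine conditionH2For_of_le _ (c := ENNReal.ofReal (333 / 400)) ?_ fun v => ?_
    · rw [ENNReal.ofReal_lt_one]; norm_num
    · have hbey : ∀ k, (bondInteraction i β).absSum (beyond v (bondSeq i v (k + 1))) = 0 := fun k =>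
        have h := mem_bondSeq i v k
        bondInteraction_absSum_beyond_eq_zero i hβ h.1 h.2.1 h.2.2
      change (bondInteraction i β).birthSum v (bondSeq i v) ≤ _
      unfold birthSum
      rw [tsum_eq_single 0]
      · refine ENNReal.ofReal_le_ofReal ?_
        have h1 : (bondInteraction i β).lam v (bondSeq i v) (0 + 1) = 111 / 400 := by
          simp only [lam]
          have := hbey 0
          rw [zero_add] at this
          rw [this, bondInteraction_absSum_star i hβ,
            show -2 * (2 * β) = -(2 * β) + -(2 * β) by ring, Real.exp_add, hexp]
          norm_num
        have h2 : ((bondSeq i v (0 + 1)).card : ℝ) ≤ 3 := by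
          exact_mod_cast (Finset.card_le_three : (bondSeq i v 1).card ≤ 3)
        rw [h1]
        linarith
      · intro k hk
        obtain ⟨k, rfl⟩ := Nat.exists_eq_succ_of_ne_zero hk
        have h1 : (bondInteraction i β).lam v (bondSeq i v) (k + 2) = 0 := by
          simp only [lam]
          rw [hbey k, hbey (k + 1), sub_self]
        change ENNReal.ofReal (_ * (bondInteraction i β).lam v (bondSeq i v) (k + 2)) = 0
        rw [h1, mul_zero, ENNReal.ofReal_zero]
  · intro h
    refine absurd h (not_lt.mpr ?_)
    refine le_trans ?_ (le_iSup _ (0 : Vertex d))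
    refine le_trans ?_ (ENNReal.le_tsum 4)
    rw [ENNReal.one_le_ofReal]
    have h1 : (bondInteraction i β).lam 0 (ball 0) (4 + 1) = 3 / 20 := by
      simp only [lam]
      rw [bondInteraction_absSum_beyond_eq_zero i hβ (self_mem_ball _ _)
        ((shift_mem_ball i _ _ _).mpr (by norm_num)) ((shift_mem_ball i _ _ _).mpr (by norm_num)),
        bondInteraction_absSum_beyond_eq i hβ (by simp [shift_mem_ball]) (by simp [shift_mem_ball]),
        hexp]
      norm_num
    have h2 : 11 ≤ (ball (0 : Vertex d) (4 + 1)).card := by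
      have h3 : ((Finset.Icc (-5 : ℤ) 5).image fun j => shift i j 0) ⊆ ball 0 (4 + 1) := by
        intro u hu
        obtain ⟨j, hj, rfl⟩ := Finset.mem_image.mp hu
        rw [Finset.mem_Icc] at hj
        rw [shift_mem_ball]
        omega
      have h4 := Finset.card_le_card h3
      rw [Finset.card_image_of_injective _ (shift_injective i 0), Int.card_Icc] at h4
      simpa using h4
    have h3 : (11 : ℝ) ≤ (ball (0 : Vertex d) (4 + 1)).card := by exact_mod_cast h2
    rw [h1]
    linarith

end Interaction

theorem mainTheorem2 (d : ℕ) (hd : 0 < d) :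
    (∀ (J : Interaction d) (B : ∀ v : Vertex d, J.Growth v), J.ConditionH2For B →
      (∀ C₀ : Finset (Vertex d), ∀ᵐ ω ∂(Interaction.sketchMeasure B C₀),
        (∃ N : ℕ, ∀ n ≥ N, Interaction.sketchProcess B C₀ n ω = ∅) ∧
        limsup (fun n => (Interaction.sketchProcess B C₀ n ω : Set (Vertex d))) atTop = ∅) ∧
      (∃! π : Measure (Config d), J.IsGibbs π) ∧
      (∀ π : Measure (Config d), J.IsGibbs π → ∀ (C₀ : Finset (Vertex d)) (σ₀ : Config d),
        (Interaction.outputLaw B C₀ σ₀).map C₀.restrict = π.map C₀.restrict)) ∧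
    (∀ J : Interaction d, J.ConditionH1 → J.ConditionH2) ∧
    (∃ J : Interaction d, J.ConditionH2 ∧ ¬ J.ConditionH1) := by
  refine ⟨fun J B hB => ⟨fun C₀ => ?_, ?_, ?_⟩, fun J h => h.conditionH2 hd,
    Interaction.exists_conditionH2_not_conditionH1 hd⟩
  · filter_upwards [(hB.extinction C₀).2] with ω hω
    refine ⟨eventually_atTop.mp hω, ?_⟩
    rw [limsup_congr (hω.mono fun n hn => by rw [hn, Finset.coe_empty])]
    exact limsup_const _
  · obtain ⟨π, hπ⟩ := J.exists_isGibbs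
    refine ⟨π, hπ, fun π' hπ' => ?_⟩
    have := hπ.1
    have := hπ'.1
    have hfin : ∀ I : Finset (Vertex d),
        IsFiniteMeasure (π.map (I.restrict : Config d → I → ℤˣ)) := fun I => inferInstance
    refine IsProjectiveLimit.unique (P := fun I => π.map I.restrict) (fun I => ?_) fun I => rfl
    exact (hπ'.outputLaw_map_restrict (B := B) (fun _ => 1) (hB.extinction I).1).symm.trans
      (hπ.outputLaw_map_restrict (B := B) (fun _ => 1) (hB.extinction I).1)
  · exact fun π hπ C₀ σ₀ => hπ.outputLaw_map_restrict σ₀ (hB.extinction C₀).1
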